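/- Let $(X,d)$ be a finite metric space with $n$ points and let $k\ge 1$, $1\le z<n$ be integers. For a set $S\subseteq X$ with non-negative vertex weights $w$ and a set $H\subseteq X$, let $\phi_0(S,H)$ be the minimum of $\max_{q\in S'}\min_{c\in H}d(q,c)$ over all $S'\subseteq S$ with $w(S\setminus S')\le z$ (so a vertex counts as $w(q)$ overlapping unit vertices, and total weight at most $z$ is discarded); for $S=X$ all weights are $1$. The weighted set $S$ is a $\mu$-coreset of $X$ if $(1-\mu)\phi_0(X,H)\le\phi_0(S,H)\le(1+\mu)\phi_0(X,H)$ for every set $H\subseteq X$ of $k$ points. Let $X_{opt}$, $|X_{opt}|=n-z$, and $A$, $|A|=k$, be inliers and centers of an optimal solution of $k$-center clustering with $z$ outliers, and assume that the metric space $(X_{opt},d)$ has doubling dimension at most $\rho>0$: for all $p\in X_{opt}$ and $r\ge0$ the points of $X_{opt}$ in the closed ball of radius $2r$ around $p$ are covered by at most $2^\rho$ balls of radius $r$ centered in $X_{opt}$. Let $\mu,\eta\in(0,1)$. Algorithm. Put $l=\kappa\,(2/\mu)^\rho k$, where $\kappa=4^\rho$; if $A\subseteq X_{opt}$ and $\mu=2^{-i}$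 for an integer $i$, then $\kappa=1$ may be taken as well. Put $t=\lceil (l+\sqrt l)/(1-\eta)\rceil$. (1) Let $E$ be a sample of $\lceil\frac{1}{1-z/n}\ln\frac1\eta\rceil$ independent uniform points of $X$. (2) Repeat $t-1$ times: let $Q$ be the $\min(2z,n)$ points of $X$ farthest from $E$, and add $\lceil 2\ln\frac1\eta\rceil$ independent uniform points of $Q$ to $E$. (3) Let $\tilde r$ be the largest distance of a point of $X$ to $E$ after the $2z$ farthest points are left out ($\tilde r=0$ if no point remains), and $X_{\tilde r}=\{p\in X: d(p,E)\le\tilde r\}$. (4) Assign each point of $X_{\tilde r}$ to a nearest point of $E$; the weight of $q\in E$ is the number of points assigned to it. (5) Add the points of $X\setminus X_{\tilde r}$ to $E$, each with weight $1$, and output the resulting weighted set. Claim. There is a constant $p>0$ depending only on $\eta$, and for every $\gamma_0<1$ a constant $C$ depending only on $\eta$ and $\gamma_0$, such that the following holds for every such instance with $z\le\gamma_0 n$. With probability at least $p$ the output is a $\mu$-coreset of $X$ for $k$-center clustering with $z$ outliers. For every outcome of the random draws, the output has at most $2z+C\,l$ points and is computed in at most $C\,l\,n$ elementary steps, given the distances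 (with the sets of farthest points and $\tilde r$ found by median-of-medians selection). Thus, for constant $\rho$, the size is $2z+O((2/\mu)^\rho k)$ and the construction time is $O((2/\mu)^\rho kn)$. -/

import Mathlib

open scoped NNReal

universe u v

/-! ## Timed computations

A deterministic computation is a value together with the number of elementary steps spent on it.
One step pays for a bounded number of elementary operations: taking a list apart or building one
cell of a list, looking up one pairwise distance, comparing two numbers or two vertices,
one arithmetic operation, or drawing one random index.  Every pass over a list below is written
as an explicit recursion that is charged for each cell it visits. -/

/-- A value together with the number of elementary steps spent on computing it. -/
structure Timed (α : Type u) where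
  val : α
  time : ℕ

namespace Timed

/-- Return a value in one step. -/
def ret {α : Type u} (a : α) : Timed α := ⟨a, 1⟩

/-- Sequential composition: the running times add up. -/
def bind {α : Type u} {β : Type v} (x : Timed α) (f : α → Timed β) : Timed β :=
  ⟨(f x.val).val, x.time + (f x.val).time⟩

/-- Spend one further step. -/
def tick {α : Type u} (x : Timed α) : Timed α := ⟨x.val, x.time + 1⟩

end Timed

/-- Length of a list. -/
def lengthT {α : Type u} : List α → Timed ℕ
  | [] => .ret 0
  | _ :: l => .tick <| (lengthT l).bind fun n => .ret (n + 1)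

/-- Apply an operation of bounded cost to all entries of a list. -/
def mapT {α : Type u} {β : Type v} (f : α → β) : List α → Timed (List β)
  | [] => .ret []
  | a :: l => .tick <| (mapT f l).bind fun r => .ret (f a :: r)

/-- Keep the entries that pass a test of bounded cost. -/
def filterT {α : Type u} (p : α → Bool) : List α → Timed (List α)
  | [] => .ret []
  | a :: l => .tick <| (filterT p l).bind fun r => .ret (if p a then a :: r else r)

/-- Number of the entries that pass a test of bounded cost. -/
def countT {α : Type u} (p : α → Bool) : List α → Timed ℕ
  | [] => .ret 0
  | a :: l => .tick <| (countT p l).bind fun c => .ret (if p a then c + 1 else c)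

/-- Concatenation of two lists. -/
def appendT {α : Type u} : List α → List α → Timed (List α)
  | [], m => .ret m
  | a :: l, m => .tick <| (appendT l m).bind fun r => .ret (a :: r)

/-- The first `n` entries of a list. -/
def takeT {α : Type u} : ℕ → List α → Timed (List α)
  | 0, _ => .ret []
  | _ + 1, [] => .ret []
  | n + 1, a :: l => .tick <| (takeT n l).bind fun r => .ret (a :: r)

/-- The entry at position `i`, found by walking along the list (`a₀` if the list is too short). -/
def nthT {α : Type u} (a₀ : α) : List α → ℕ → Timed α
  | [], _ => .ret a₀
  | a :: _, 0 => .ret a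
  | _ :: l, i + 1 => .tick (nthT a₀ l i)

/-- Membership test. -/
def memT {α : Type u} [DecidableEq α] (x : α) : List α → Timed Bool
  | [] => .ret false
  | a :: l => .tick (if a = x then .ret true else memT x l)

/-! ## Linear time selection (median of medians) -/

section Selection

variable {α : Type u} [LinearOrder α]

/-- Insert an entry into a sorted list. -/
def insertT (a : α) : List α → Timed (List α)
  | [] => .ret [a]
  | b :: l => .tick (if a ≤ b then .ret (a :: b :: l)
      else (insertT a l).bind fun r => .ret (b :: r))

/-- Insertion sort; used for lists of bounded length only. -/
def sortT : List α → Timed (List α)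
  | [] => .ret []
  | a :: l => .tick <| (sortT l).bind fun s => insertT a s

/-- The median of a short list. -/
def medianT (a₀ : α) (l : List α) : Timed α :=
  (sortT l).bind fun s => (lengthT s).bind fun m => nthT a₀ s (m / 2)

/-- The medians of the consecutive groups of five (the last group may be smaller). -/
def mediansT (a₀ : α) : List α → Timed (List α)
  | a :: b :: c :: d :: e :: l => .tick <| (medianT a₀ [a, b, c, d, e]).bind fun x =>
      (mediansT a₀ l).bind fun r => .ret (x :: r)
  | [] => .ret []
  | l => .tick <| (medianT a₀ l).bind fun x => .ret [x]

/-- The entry at position `i` (counted from `0`) of the list `l` in increasing order.  The first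
argument only bounds the depth of the recursion; the length of `l` always suffices. -/
def selectT (a₀ : α) : ℕ → List α → ℕ → Timed α
  | 0, _, _ => .ret a₀
  | fuel + 1, l, i => .tick <| (lengthT l).bind fun n =>
      if n ≤ 140 then (sortT l).bind fun s => nthT a₀ s i
      else
        (mediansT a₀ l).bind fun ms =>
        (lengthT ms).bind fun m =>
        (selectT a₀ fuel ms (m / 2)).bind fun x =>
        (filterT (fun y => decide (y < x)) l).bind fun lo =>
        (filterT (fun y => decide (y = x)) l).bind fun eq =>
        (filterT (fun y => decide (x < y)) l).bind fun hi =>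
        (lengthT lo).bind fun a =>
        (lengthT eq).bind fun b =>
        .tick (if i < a then selectT a₀ fuel lo i
          else if i < a + b then .ret x
          else selectT a₀ fuel hi (i - a - b))

end Selection

/-! ## `k`-center clustering with outliers, weighted coresets, doubling dimension -/

section Clustering

variable {X : Type u} [MetricSpace X]

/-- `max_{p ∈ X'} min_{c ∈ A} d(p, c)`  (it is `0` for empty `X'`). -/
noncomputable def clusterCost (X' A : Finset X) : ℝ :=
  ⨆ p : X', Metric.infDist (p : X) (A : Set X)

/-- `X'` (of size `n - z`) and the set `A` of `k` centers form an optimal solution of `k`-center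
clustering with `z` outliers. -/
def IsOptimalSolution [Fintype X] (k z : ℕ) (X' A : Finset X) : Prop :=
  X'.card + z = Fintype.card X ∧ A.card = k ∧
    ∀ Y B : Finset X, Fintype.card X ≤ Y.card + z → B.card = k →
      clusterCost X' A ≤ clusterCost Y B

/-- The cost `φ₀(S, H)` of the centers `H` on the set `S` with vertex weights `w`, each
vertex being regarded as `w q` overlapping copies: the minimum of
`max_{q ∈ S'} min_{c ∈ H} d(q, c)` over all `S' ⊆ S` that leave out weight at most `z`. -/
noncomputable def phi [DecidableEq X] (z : ℕ) (S : Finset X) (w : X → ℝ≥0) (H : Finset X) : ℝ :=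
  sInf {r : ℝ | ∃ S' ⊆ S, ∑ q ∈ S \ S', w q ≤ (z : ℝ≥0) ∧ r = clusterCost S' H}

/-- `S` with the weights `w` is a `μ`-coreset of `X` for `k`-center clustering with `z` outliers:
`φ₀(S, H) ∈ (1 ± μ) φ₀(X, H)` for every set `H` of `k` vertices. -/
def IsCoreset [Fintype X] [DecidableEq X] (μ : ℝ) (k z : ℕ) (S : Finset X) (w : X → ℝ≥0) : Prop :=
  ∀ H : Finset X, H.card = k →
    (1 - μ) * phi z Finset.univ (fun _ => 1) H ≤ phi z S w H ∧
      phi z S w H ≤ (1 + μ) * phi z Finset.univ (fun _ => 1) H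

/-- The metric `(S, d)` has doubling dimension at most `ρ`: for `p ∈ S` and `r ≥ 0`, the part of
`S` in the closed ball around `p` of radius `2r` is covered by at most `2 ^ ρ` balls of the metric
`(S, d)` with radius `r`.  (The doubling dimension is the smallest such `ρ`.) -/
def DoublingDimLE (S : Finset X) (ρ : ℝ) : Prop :=
  ∀ p ∈ S, ∀ r : ℝ, 0 ≤ r → ∃ B ⊆ S, (B.card : ℝ) ≤ 2 ^ ρ ∧
    ∀ q ∈ S, dist q p ≤ 2 * r → ∃ b ∈ B, dist q b ≤ r

end Clustering

/-! ## The greedy bi-criteria algorithm (with `ε = 1`) and the coreset construction -/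

/-- What is stored for a vertex `p`: a nearest neighbor of `p` in the current set `E` of selected
vertices, and the distance `d(p, E)`. -/
structure Entry (X : Type u) where
  vertex : X
  nearest : X
  distE : ℝ

/-- The current set `E` (a list without repetitions) and the table of all vertices. -/
structure GreedyState (X : Type u) where
  E : List X
  table : List (Entry X)

/-- Size `⌈log(1/η) / (1 - γ)⌉`, `γ = z / n`, of the initial sample. -/
noncomputable def initialSize (n z : ℕ) (η : ℝ) : ℕ :=
  ⌈1 / (1 - (z : ℝ) / n) * Real.log (1 / η)⌉₊

/-- Size `⌈((1 + ε) / ε) log(1/η)⌉`, `ε = 1`, of the sample in every later round. -/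
noncomputable def roundSize (η : ℝ) : ℕ := ⌈2 * Real.log (1 / η)⌉₊

/-- The parameter `t = ⌈(l + √l) / (1 - η)⌉`; the initial sample counts as the first round. -/
noncomputable def numRounds (l η : ℝ) : ℕ := ⌈(l + Real.sqrt l) / (1 - η)⌉₊

/-- The outcomes of all the random draws: the positions in `X` of the initial sample and, for each
of the `t - 1` later rounds, the positions in the set of the (at most) `2z` farthest vertices. -/
abbrev Draws (n z : ℕ) (l η : ℝ) : Type :=
  (Fin (initialSize n z η) → Fin n) ×
    (Fin (numRounds l η - 1) → Fin (roundSize η) → Fin (min (2 * z) n))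

section Algorithm

variable {X : Type u} [MetricSpace X] [DecidableEq X]

/-- The entries of `l` at the given positions. -/
def pickT (a₀ : X) (l : List X) : List ℕ → Timed (List X)
  | [] => .ret []
  | i :: is => .tick <| (nthT a₀ l i).bind fun x => (pickT a₀ l is).bind fun r => .ret (x :: r)

/-- The state with `E = {s}`; the list `V` enumerates the vertices. -/
noncomputable def initStateT (s : X) (V : List X) : Timed (GreedyState X) :=
  (mapT (fun p => (⟨p, s, dist p s⟩ : Entry X)) V).bind fun tab => .ret ⟨[s], tab⟩

/-- Add a vertex to `E` and update the distances to `E`. -/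
noncomputable def addCenterT (s : X) (σ : GreedyState X) : Timed (GreedyState X) :=
  (memT s σ.E).bind fun b =>
    if b then .ret σ
    else
      (mapT (fun e : Entry X =>
        if dist e.vertex s < e.distE then ⟨e.vertex, s, dist e.vertex s⟩ else e) σ.table).bind
      fun tab => .ret ⟨s :: σ.E, tab⟩

/-- Add a list of vertices to `E`. -/
noncomputable def addCentersT : List X → GreedyState X → Timed (GreedyState X)
  | [], σ => .ret σ
  | s :: ss, σ => .tick <| (addCenterT s σ).bind fun σ' => addCentersT ss σ'

/-- The `m` vertices farthest from `E` (all `n` vertices if `n ≤ m`). -/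
noncomputable def farthestT (n m : ℕ) (tab : List (Entry X)) : Timed (List X) :=
  if n ≤ m then mapT Entry.vertex tab
  else
    (mapT Entry.distE tab).bind fun ds =>
    (selectT 0 n ds (n - m)).bind fun τ =>
    (filterT (fun e => decide (τ < e.distE)) tab).bind fun hi =>
    (filterT (fun e => decide (e.distE = τ)) tab).bind fun eq =>
    (appendT hi eq).bind fun l =>
    (takeT m l).bind fun q => mapT Entry.vertex q

/-- The largest distance to `E` once the `m` farthest vertices are left out (`0` if no vertex
remains). -/
noncomputable def radiusT (n m : ℕ) (tab : List (Entry X)) : Timed ℝ :=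
  if n ≤ m then .ret 0
  else (mapT Entry.distE tab).bind fun ds => selectT 0 n ds (n - 1 - m)

/-- The rounds after the initial sample, one for each list of drawn positions: take the `2z`
vertices farthest from `E`, select those at the drawn positions, and add them to `E`. -/
noncomputable def roundsT (n z : ℕ) (a₀ : X) :
    List (List ℕ) → GreedyState X → Timed (GreedyState X)
  | [], σ => .ret σ
  | is :: rest, σ => .tick <|
      (farthestT n (2 * z) σ.table).bind fun Q =>
      (pickT a₀ Q is).bind fun ss =>
      (addCentersT ss σ).bind fun σ' => roundsT n z a₀ rest σ'

/-- The bi-criteria algorithm: the initial sample from `X`, followed by the later rounds.  The list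
`V` enumerates the `n` vertices.  (An initial sample is never empty for `0 < η < 1` and `z < n`.) -/
noncomputable def greedyT (n z : ℕ) (V : List X) (first : List ℕ) (later : List (List ℕ)) :
    Timed (GreedyState X) :=
  match V with
  | [] => .ret ⟨[], []⟩
  | a₀ :: _ => (pickT a₀ V first).bind fun ss =>
      match ss with
      | [] => .ret ⟨[], []⟩
      | s :: ss => (initStateT s V).bind fun σ₀ =>
          (addCentersT ss σ₀).bind fun σ => roundsT n z a₀ later σ

/-- Each `q ∈ E` with its weight, the number of listed vertices that are assigned to it. -/
def weightsT (near : List (Entry X)) : List X → Timed (List (X × ℕ))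
  | [] => .ret []
  | q :: E => .tick <| (countT (fun e => decide (e.nearest = q)) near).bind fun c =>
      (weightsT near E).bind fun r => .ret ((q, c) :: r)

/-- The coreset construction, run on given outcomes of the random draws. -/
noncomputable def coresetT (n z : ℕ) (l η : ℝ) (V : List X) (ω : Draws n z l η) :
    Timed (List (X × ℕ)) :=
  .tick <|
  (greedyT n z V (List.ofFn fun i => (ω.1 i : ℕ))
    (List.ofFn fun j => List.ofFn fun i => (ω.2 j i : ℕ))).bind fun σ =>
  (radiusT n (2 * z) σ.table).bind fun r =>
  (filterT (fun e => decide (e.distE ≤ r)) σ.table).bind fun near =>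
  (filterT (fun e => decide (r < e.distE)) σ.table).bind fun far =>
  (weightsT near σ.E).bind fun inner =>
  (mapT (fun e : Entry X => (e.vertex, 1)) far).bind fun outer =>
  appendT inner outer

/-- The set of vertices of a list of weighted vertices. -/
def outSet (out : List (X × ℕ)) : Finset X := (out.map Prod.fst).toFinset

/-- The weight of a vertex in a list of weighted vertices. -/
def outWeight (out : List (X × ℕ)) (q : X) : ℝ≥0 :=
  (((out.filter fun a => decide (a.1 = q)).map Prod.snd).sum : ℕ)

open Classical in
/-- The probability, over independent uniform draws, that the output is a `μ`-coreset. -/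
noncomputable def coresetProb [Fintype X] (μ : ℝ) (k z : ℕ) (l η : ℝ) (V : List X) : ℝ :=
  ((Finset.univ.filter fun ω : Draws (Fintype.card X) z l η =>
      IsCoreset μ k z (outSet (coresetT (Fintype.card X) z l η V ω).val)
        (outWeight (coresetT (Fintype.card X) z l η V ω).val)).card : ℝ) /
    Fintype.card (Draws (Fintype.card X) z l η)

end Algorithm

/-! ## Values and running times of the elementary list operations -/

namespace Timed

variable {α : Type u} {β : Type v}

/-! Let `r` be the optimal cost. The doubling property, iterated inside each optimal cluster, covers
the inliers by balls of radius `μr/2` around a set `B` of at most `l` points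
(`exists_inlier_cover`). Call a ball missed if `E` has no point in it. Once a ball is hit, all its
inliers lie within `μr` of `E`.

Progress is measured by `missRank`: the number of missed balls, or `0` as soon as at most `2z`
points are farther than `μr` from `E`. While it is positive, each of the `2z` farthest points is
farther than `μr` from `E`. At most `z` of them are outliers, so a uniform draw is an inlier with
probability at least `1/2`. The ball of such an inlier was missed, by the triangle inequality, and
is now hit (`missRank_lt`). With `⌈2 ln(1/η)⌉` draws a round therefore lowers the rank with
probability at least `1 - η`, whatever happened before. The initial sample behaves like a round that
starts from the empty set.

The rounds are not independent, but the chance of a positive final rank is at most the chance of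
fewer than `|B|` successes in `t` independent trials of success probability `1 - η`
(`card_rank_ne_zero_le`, `card_greedy_fail_le`). Since `t(1 - η) ≥ l + √l`, the one-sided Chebyshev
inequality bounds this by `2η/(1 + 2η)` (`failBound_le_of_rounds`), which gives `p = 1/(1 + 2η)`.

At rank `0` at most `2z` points are farther than `μr` from `E`, so `r̃ ≤ μr`. The output then arises
from `X` by moving every point by at most `μr`, with weights counting the points moved to each
place. This changes each cost `φ₀(·, H)` by at most `μr`, and `r ≤ φ₀(X, H)` by optimality
(`isCoreset_of_map`).

Size and time hold for every outcome: each draw adds at most one point to `E` and costs `O(n)`, at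
most `2z` points lie beyond `r̃`, and median-of-medians selection is linear (`selectT_spec`). -/

@[simp] theorem ret_val (a : α) : (ret a).val = a := rfl
@[simp] theorem ret_time (a : α) : (ret a).time = 1 := rfl
@[simp] theorem bind_val (x : Timed α) (f : α → Timed β) : (x.bind f).val = (f x.val).val := rfl
@[simp] theorem bind_time (x : Timed α) (f : α → Timed β) :
    (x.bind f).time = x.time + (f x.val).time := rfl
@[simp] theorem tick_val (x : Timed α) : x.tick.val = x.val := rfl
@[simp] theorem tick_time (x : Timed α) : x.tick.time = x.time + 1 := rfl

end Timed

section ListOps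

variable {α : Type u} {β : Type v}

@[simp] theorem lengthT_val (l : List α) : (lengthT l).val = l.length := by
  induction l with
  | nil => rfl
  | cons a l ih => simp [lengthT, ih]

@[simp] theorem lengthT_time (l : List α) : (lengthT l).time = 2 * l.length + 1 := by
  induction l with
  | nil => rfl
  | cons a l ih => simp [lengthT, ih]; omega

@[simp] theorem mapT_val (f : α → β) (l : List α) : (mapT f l).val = l.map f := by
  induction l with
  | nil => rfl
  | cons a l ih => simp [mapT, ih]

@[simp] theorem mapT_time (f : α → β) (l : List α) : (mapT f l).time = 2 * l.length + 1 := by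
  induction l with
  | nil => rfl
  | cons a l ih => simp [mapT, ih]; omega

@[simp] theorem filterT_val (p : α → Bool) (l : List α) : (filterT p l).val = l.filter p := by
  induction l with
  | nil => rfl
  | cons a l ih => simp [filterT, ih, List.filter_cons]

@[simp] theorem filterT_time (p : α → Bool) (l : List α) :
    (filterT p l).time = 2 * l.length + 1 := by
  induction l with
  | nil => rfl
  | cons a l ih => simp [filterT, ih]; omega

@[simp] theorem countT_val (p : α → Bool) (l : List α) : (countT p l).val = l.countP p := by
  induction l with
  | nil => rfl
  | cons a l ih => simp only [countT, Timed.tick_val, Timed.bind_val, ih, Timed.ret_val,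
      List.countP_cons]; split <;> simp

@[simp] theorem countT_time (p : α → Bool) (l : List α) :
    (countT p l).time = 2 * l.length + 1 := by
  induction l with
  | nil => rfl
  | cons a l ih => simp [countT, ih]; omega

@[simp] theorem appendT_val (l m : List α) : (appendT l m).val = l ++ m := by
  induction l with
  | nil => rfl
  | cons a l ih => simp [appendT, ih]

@[simp] theorem appendT_time (l m : List α) : (appendT l m).time = 2 * l.length + 1 := by
  induction l with
  | nil => rfl
  | cons a l ih => simp [appendT, ih]; omega

@[simp] theorem takeT_val (n : ℕ) (l : List α) : (takeT n l).val = l.take n := by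
  induction l generalizing n with
  | nil => cases n <;> simp [takeT]
  | cons a l ih => cases n <;> simp [takeT, ih]

theorem takeT_time_le (n : ℕ) (l : List α) : (takeT n l).time ≤ 2 * l.length + 1 := by
  induction l generalizing n with
  | nil => cases n <;> simp [takeT]
  | cons a l ih =>
    cases n with
    | zero => simp [takeT]
    | succ n => have := ih n; simp [takeT]; omega

@[simp] theorem nthT_val (a₀ : α) (l : List α) (i : ℕ) : (nthT a₀ l i).val = l.getD i a₀ := by
  induction l generalizing i with
  | nil => simp [nthT]
  | cons a l ih => cases i <;> simp [nthT, ih]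

theorem nthT_time_le (a₀ : α) (l : List α) (i : ℕ) : (nthT a₀ l i).time ≤ l.length + 1 := by
  induction l generalizing i with
  | nil => simp [nthT]
  | cons a l ih =>
    cases i with
    | zero => simp [nthT]
    | succ i => have := ih i; simp [nthT]; omega

@[simp] theorem memT_val [DecidableEq α] (x : α) (l : List α) :
    (memT x l).val = decide (x ∈ l) := by
  induction l with
  | nil => simp [memT]
  | cons a l ih =>
    by_cases h : a = x
    · simp [memT, h]
    · simp [memT, h, ih, Ne.symm h]

theorem memT_time_le [DecidableEq α] (x : α) (l : List α) :
    (memT x l).time ≤ l.length + 1 := by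
  induction l with
  | nil => simp [memT]
  | cons a l ih =>
    by_cases h : a = x
    · simp [memT, h]
    · simp [memT, h]; omega

end ListOps

/-! ## Linear time selection -/

section SelectionSpec

variable {α : Type u} [LinearOrder α]

@[simp] theorem insertT_val (a : α) (l : List α) :
    (insertT a l).val = l.orderedInsert (· ≤ ·) a := by
  induction l with
  | nil => simp [insertT]
  | cons b l ih => by_cases h : a ≤ b <;> simp [insertT, h, ih]

theorem insertT_time_le (a : α) (l : List α) : (insertT a l).time ≤ 2 * l.length + 1 := by
  induction l with
  | nil => simp [insertT]
  | cons b l ih => by_cases h : a ≤ b <;> simp [insertT, h] <;> omega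

@[simp] theorem sortT_val (l : List α) : (sortT l).val = l.insertionSort (· ≤ ·) := by
  induction l with
  | nil => rfl
  | cons b l ih => simp [sortT, ih]

theorem sortT_time_le (l : List α) :
    (sortT l).time ≤ l.length * l.length + l.length + 1 := by
  induction l with
  | nil => simp [sortT]
  | cons b l ih =>
    have := insertT_time_le b (sortT l).val
    simp [sortT] at this ⊢
    nlinarith

theorem length_sub_le_countP_of_sorted {s : List α} (hs : s.Pairwise (· ≤ ·)) {i : ℕ}
    (hi : i < s.length) : s.length - i ≤ s.countP (fun y => decide (s[i] ≤ y)) := by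
  have h : (s.drop i).countP (fun y => decide (s[i] ≤ y)) = (s.drop i).length := by
    rw [List.countP_eq_length]
    intro y hy
    obtain ⟨j, hj, rfl⟩ := List.getElem_of_mem hy
    simp only [List.getElem_drop, decide_eq_true_eq]
    exact hs.sortedLE.getElem_le_getElem_of_le (by omega)
  calc s.length - i = (s.drop i).length := by simp
    _ ≤ _ := by rw [← h]; exact (List.drop_sublist i s).countP_le

theorem lt_countP_of_sorted {s : List α} (hs : s.Pairwise (· ≤ ·)) {i : ℕ}
    (hi : i < s.length) : i < s.countP (fun y => decide (y ≤ s[i])) := by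
  have h : (s.take (i + 1)).countP (fun y => decide (y ≤ s[i])) = (s.take (i + 1)).length := by
    rw [List.countP_eq_length]
    intro y hy
    obtain ⟨j, hj, rfl⟩ := List.getElem_of_mem hy
    simp only [List.getElem_take, decide_eq_true_eq]
    simp at hj
    exact hs.sortedLE.getElem_le_getElem_of_le (by omega)
  calc i < (s.take (i + 1)).length := by simp; omega
    _ ≤ _ := by rw [← h]; exact (List.take_sublist _ s).countP_le

theorem List.countP_lt_add_countP_ge (l : List α) (x : α) :
    l.countP (fun y => decide (y < x)) + l.countP (fun y => decide (x ≤ y)) = l.length := by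
  induction l with
  | nil => rfl
  | cons a l ih =>
    simp only [List.countP_cons, List.length_cons, decide_eq_true_eq]
    rcases lt_or_ge a x with h | h
    · simp [h, not_le.2 h]; omega
    · simp [h, not_lt.2 h]; omega

theorem List.countP_le_add_countP_gt (l : List α) (x : α) :
    l.countP (fun y => decide (y ≤ x)) + l.countP (fun y => decide (x < y)) = l.length := by
  induction l with
  | nil => rfl
  | cons a l ih =>
    simp only [List.countP_cons, List.length_cons, decide_eq_true_eq]
    rcases le_or_gt a x with h | h
    · simp [h, not_lt.2 h]; omega
    · simp [h, not_le.2 h]; omega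

theorem List.countP_lt_add_countP_eq (l : List α) (x : α) :
    l.countP (fun y => decide (y < x)) + l.countP (fun y => decide (y = x)) =
      l.countP (fun y => decide (y ≤ x)) := by
  induction l with
  | nil => rfl
  | cons a l ih =>
    simp only [List.countP_cons, decide_eq_true_eq]
    rcases lt_trichotomy a x with h | h | h
    · simp [h, h.le, h.ne]; omega
    · simp [h]; omega
    · simp [not_lt.2 h.le, not_le.2 h, h.ne']; omega

/-- `x` occupies position `i` (counted from `0`) of `l` in increasing order. -/
def IsOrderStat (l : List α) (i : ℕ) (x : α) : Prop :=
  l.countP (fun y => decide (y < x)) ≤ i ∧ i < l.countP (fun y => decide (y ≤ x))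

theorem isOrderStat_sort (a₀ : α) (l : List α) {i : ℕ} (hi : i < l.length) :
    IsOrderStat l i ((sortT l).bind fun s => nthT a₀ s i).val := by
  have hs : (l.insertionSort (· ≤ ·)).Pairwise (· ≤ ·) := List.pairwise_insertionSort _ _
  have hp := List.perm_insertionSort (· ≤ ·) l
  have hi' : i < (l.insertionSort (· ≤ ·)).length := by simpa using hi
  simp only [Timed.bind_val, sortT_val, nthT_val, List.getD_eq_getElem _ _ hi']
  have h1 := length_sub_le_countP_of_sorted hs hi'
  have h2 := lt_countP_of_sorted hs hi'
  set x := (l.insertionSort (· ≤ ·))[i]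
  rw [hp.countP_eq] at h1 h2
  have := l.countP_lt_add_countP_ge x
  simp at h1
  exact ⟨by omega, h2⟩

theorem IsOrderStat.mem {l : List α} {i : ℕ} {x : α} (h : IsOrderStat l i x) : x ∈ l := by
  have := l.countP_lt_add_countP_eq x
  have h' : 0 < l.countP (fun y => decide (y = x)) := by
    have := h.1; have := h.2; omega
  simpa using List.countP_pos_iff.1 h'

theorem isOrderStat_medianT (a₀ : α) {l : List α} (hl : l ≠ []) :
    IsOrderStat l (l.length / 2) (medianT a₀ l).val := by
  have h := List.length_pos_iff.2 hl
  have := isOrderStat_sort a₀ l (i := l.length / 2) (by omega)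
  simpa [medianT] using this

theorem medianT_time_le (a₀ : α) {l : List α} (hl : l.length ≤ 5) :
    (medianT a₀ l).time ≤ 48 := by
  have h1 := sortT_time_le l
  have h2 := nthT_time_le a₀ (l.insertionSort (· ≤ ·)) (l.length / 2)
  simp [medianT] at h2 ⊢
  nlinarith

theorem mediansT_cons5 (a₀ a b c d e : α) (l : List α) :
    mediansT a₀ (a :: b :: c :: d :: e :: l) =
      (.tick <| (medianT a₀ [a, b, c, d, e]).bind fun x =>
      (mediansT a₀ l).bind fun r => .ret (x :: r)) := by
  rw [mediansT]

theorem mediansT_short (a₀ : α) {l : List α} (h0 : l ≠ []) (h : l.length < 5) :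
    mediansT a₀ l = (.tick <| (medianT a₀ l).bind fun x => .ret [x]) := by
  match l, h0, h with
  | [a], _, _ => simp [mediansT]
  | [a, b], _, _ => simp [mediansT]
  | [a, b, c], _, _ => simp [mediansT]
  | [a, b, c, d], _, _ => simp [mediansT]

omit [LinearOrder α] in
-- The cases follow the clauses of `mediansT`, with the four short lists merged into one.
theorem List.five_induction {P : List α → Prop} (nil : P [])
    (short : ∀ l : List α, l ≠ [] → l.length < 5 → P l)
    (cons : ∀ a b c d e l, P l → P (a :: b :: c :: d :: e :: l)) : ∀ l, P l
  | [] => nil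
  | [_] => short _ (by simp) (by simp)
  | [_, _] => short _ (by simp) (by simp)
  | [_, _, _] => short _ (by simp) (by simp)
  | [_, _, _, _] => short _ (by simp) (by simp)
  | _ :: _ :: _ :: _ :: _ :: l => cons _ _ _ _ _ l (List.five_induction nil short cons l)

theorem mediansT_length (a₀ : α) (l : List α) :
    (mediansT a₀ l).val.length = (l.length + 4) / 5 := by
  induction l using List.five_induction with
  | nil => simp [mediansT]
  | short l h0 h =>
    have := List.length_pos_iff.2 h0
    simp [mediansT_short a₀ h0 h]; omega
  | cons a b c d e l ih => simp [mediansT_cons5, ih]; omega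

theorem mediansT_time_le (a₀ : α) (l : List α) :
    (mediansT a₀ l).time ≤ 50 * l.length + 1 := by
  induction l using List.five_induction with
  | nil => simp [mediansT]
  | short l h0 h =>
    have := List.length_pos_iff.2 h0
    have := medianT_time_le a₀ h.le
    simp [mediansT_short a₀ h0 h]; omega
  | cons a b c d e l ih =>
    have := medianT_time_le a₀ (l := [a, b, c, d, e]) (by simp)
    simp [mediansT_cons5]; omega

/-- A full group whose median is at least `x` has three entries at least `x`. The last, shorter
group is sure of only one, and the summand `2` makes up for it. Applied to the pivot, this shows
that about `3/10` of the list is not below it. -/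
theorem countP_mediansT_ge (a₀ : α) (l : List α) (x : α) :
    3 * (mediansT a₀ l).val.countP (fun y => decide (x ≤ y)) ≤
      l.countP (fun y => decide (x ≤ y)) + 2 := by
  have key : ∀ l : List α, l ≠ [] → x ≤ (medianT a₀ l).val →
      l.length - l.length / 2 ≤ l.countP (fun y => decide (x ≤ y)) := by
    intro l hl hx
    have h1 := (isOrderStat_medianT a₀ hl).1
    have h2 := l.countP_lt_add_countP_ge (medianT a₀ l).val
    have h3 : l.countP (fun y => decide ((medianT a₀ l).val ≤ y)) ≤
        l.countP (fun y => decide (x ≤ y)) :=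
      List.countP_mono_left fun y _ hy => by
        simp only [decide_eq_true_eq] at hy ⊢; exact hx.trans hy
    omega
  induction l using List.five_induction with
  | nil => simp [mediansT]
  | short l h0 h =>
    have := List.length_pos_iff.2 h0
    have := key l h0
    simp only [mediansT_short a₀ h0 h, Timed.tick_val, Timed.bind_val, Timed.ret_val,
      List.countP_singleton, decide_eq_true_eq]
    split_ifs with hx
    · have := this hx; omega
    · omega
  | cons a b c d e l ih =>
    have := key [a, b, c, d, e] (by simp)
    have h2 : (a :: b :: c :: d :: e :: l) = [a, b, c, d, e] ++ l := rfl
    rw [mediansT_cons5, h2, List.countP_append]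
    simp only [Timed.tick_val, Timed.bind_val, Timed.ret_val, List.countP_cons (l := (mediansT a₀ l).val), decide_eq_true_eq]
    split_ifs with hx
    · have := this hx
      have h3 : [a, b, c, d, e].length = 5 := rfl
      omega
    · omega

theorem countP_mediansT_le (a₀ : α) (l : List α) (x : α) :
    3 * (mediansT a₀ l).val.countP (fun y => decide (y ≤ x)) ≤
      l.countP (fun y => decide (y ≤ x)) + 2 := by
  have key : ∀ l : List α, l ≠ [] → (medianT a₀ l).val ≤ x →
      l.length / 2 < l.countP (fun y => decide (y ≤ x)) := by
    intro l hl hx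
    have h1 := (isOrderStat_medianT a₀ hl).2
    have h3 : l.countP (fun y => decide (y ≤ (medianT a₀ l).val)) ≤
        l.countP (fun y => decide (y ≤ x)) :=
      List.countP_mono_left fun y _ hy => by
        simp only [decide_eq_true_eq] at hy ⊢; exact hy.trans hx
    omega
  induction l using List.five_induction with
  | nil => simp [mediansT]
  | short l h0 h =>
    have := List.length_pos_iff.2 h0
    have := key l h0
    simp only [mediansT_short a₀ h0 h, Timed.tick_val, Timed.bind_val, Timed.ret_val,
      List.countP_singleton, decide_eq_true_eq]
    split_ifs with hx
    · have := this hx; omega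
    · omega
  | cons a b c d e l ih =>
    have := key [a, b, c, d, e] (by simp)
    have h2 : (a :: b :: c :: d :: e :: l) = [a, b, c, d, e] ++ l := rfl
    rw [mediansT_cons5, h2, List.countP_append]
    simp only [Timed.tick_val, Timed.bind_val, Timed.ret_val, List.countP_cons (l := (mediansT a₀ l).val), decide_eq_true_eq]
    split_ifs with hx
    · have := this hx
      have h3 : [a, b, c, d, e].length = 5 := rfl
      omega
    · omega

/-- One level of the recursion of `selectT` on a long list, with pivot `x`. -/
theorem selectT_succ (a₀ : α) (fuel : ℕ) (l : List α) (i : ℕ) (h : 140 < l.length) (x : α)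
    (hx : x = (selectT a₀ fuel (mediansT a₀ l).val ((mediansT a₀ l).val.length / 2)).val) :
    let lo := l.filter (fun y => decide (y < x))
    let eq := l.filter (fun y => decide (y = x))
    let hi := l.filter (fun y => decide (x < y))
    let next := if i < lo.length then selectT a₀ fuel lo i
          else if i < lo.length + eq.length then .ret x
          else selectT a₀ fuel hi (i - lo.length - eq.length)
    (selectT a₀ (fuel + 1) l i).val = next.val ∧
    (selectT a₀ (fuel + 1) l i).time = next.time + (8 * l.length + 8) + (mediansT a₀ l).time
      + 2 * (mediansT a₀ l).val.length +
      (selectT a₀ fuel (mediansT a₀ l).val ((mediansT a₀ l).val.length / 2)).time +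
      2 * lo.length + 2 * eq.length + 1 := by
  subst hx
  constructor
  · rw [selectT]; simp [not_le.2 h]
  · rw [selectT]; simp [not_le.2 h]; ring

/-- With `n` the length, at least half of the `⌈n/5⌉` medians lie on either side of the pivot
(inclusive), so each of the two remaining lists has at most `7n/10 + 2` entries. The passes at one
level cost less than `61n` plus a constant. As `1/5 + 7/10 < 1`, the bound `1000(n + 1)` reproduces
itself; the additive constants are absorbed because `n > 140`. Up to `140` the quadratic sort fits
below the same bound. -/
theorem selectT_spec (a₀ : α) (fuel : ℕ) (l : List α) (hl : l.length ≤ fuel) :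
    (∀ i < l.length, IsOrderStat l i (selectT a₀ fuel l i).val) ∧
      ∀ i, (selectT a₀ fuel l i).time ≤ 1000 * (l.length + 1) := by
  induction fuel generalizing l with
  | zero => simp [selectT, List.length_eq_zero_iff.1 (Nat.le_zero.1 hl)]
  | succ fuel ih =>
    rcases le_or_gt l.length 140 with h | h
    · constructor
      · intro i hi
        have := isOrderStat_sort a₀ l hi
        rw [selectT]
        simpa [h] using this
      · intro i
        have h1 := sortT_time_le l
        have h2 := nthT_time_le a₀ (l.insertionSort (· ≤ ·)) i
        rw [selectT]
        simp [h] at h2 ⊢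
        nlinarith
    · have hm := mediansT_length a₀ l
      obtain ⟨ihm, ihmt⟩ := ih (mediansT a₀ l).val (by omega)
      replace ihm := ihm ((mediansT a₀ l).val.length / 2) (by omega)
      replace ihmt := ihmt ((mediansT a₀ l).val.length / 2)
      obtain ⟨x, hx⟩ : ∃ x, x =
        (selectT a₀ fuel (mediansT a₀ l).val ((mediansT a₀ l).val.length / 2)).val := ⟨_, rfl⟩
      have hrec := fun i => selectT_succ a₀ fuel l i h x hx
      rw [← hx] at ihm
      have c1 := countP_mediansT_ge a₀ l x
      have c2 := countP_mediansT_le a₀ l x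
      have c3 := (mediansT a₀ l).val.countP_lt_add_countP_ge x
      have c4 := l.countP_lt_add_countP_ge x
      have c5 := l.countP_le_add_countP_gt x
      have c6 := l.countP_lt_add_countP_eq x
      have c7 := ihm.1
      have c8 := ihm.2
      have tm := mediansT_time_le a₀ l
      simp only [← List.countP_eq_length_filter] at hrec
      obtain ⟨ihlo, ihlot⟩ := ih (l.filter (fun y => decide (y < x))) (by
        rw [← List.countP_eq_length_filter]; omega)
      obtain ⟨ihhi, ihhit⟩ := ih (l.filter (fun y => decide (x < y))) (by
        rw [← List.countP_eq_length_filter]; omega)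
      simp only [← List.countP_eq_length_filter] at ihlo ihlot ihhi ihhit
      constructor
      · intro i hi
        rw [(hrec i).1]
        split_ifs with h1 h2
        · have := ihlo i h1
          have hmem := this.mem
          obtain ⟨g1, g2⟩ := this
          set v := (selectT a₀ fuel (l.filter (fun y => decide (y < x))) i).val
          have hv : v < x := by simpa using (List.mem_filter.1 hmem).2
          rw [List.countP_filter] at g1 g2
          -- Entries below `v` are also below the pivot, so filtering loses none of those that
          -- count.
          refine ⟨(List.countP_mono_left ?_).trans g1, g2.trans_le (List.countP_mono_left ?_)⟩
          · intro y _ hy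
            simp only [decide_eq_true_eq, Bool.and_eq_true] at hy ⊢
            exact ⟨hy, hy.trans hv⟩
          · intro y _ hy
            simp only [decide_eq_true_eq, Bool.and_eq_true] at hy ⊢
            exact hy.1
        · have : IsOrderStat l i x := ⟨by omega, by omega⟩
          exact this
        · have := ihhi (i - l.countP (fun y => decide (y < x)) -
            l.countP (fun y => decide (y = x))) (by omega)
          have hmem := this.mem
          obtain ⟨g1, g2⟩ := this
          set v := (selectT a₀ fuel (l.filter (fun y => decide (x < y)))
            (i - l.countP (fun y => decide (y < x)) - l.countP (fun y => decide (y = x)))).val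
          have hv : x < v := by simpa using (List.mem_filter.1 hmem).2
          rw [List.countP_filter] at g1 g2
          -- Entries up to the pivot all lie below `v`. Hence ranks in `l` are ranks in the upper
          -- part shifted by the number of these entries, which is what the recursive call subtracts
          -- from `i`.
          have split : ∀ q : α → Bool, (∀ y, y ≤ x → q y = true) →
              l.countP q = l.countP (fun y => decide (y ≤ x)) +
                l.countP (fun y => q y && decide (x < y)) := by
            intro q hq
            clear * - hq
            induction l with
            | nil => rfl
            | cons a l ih =>
              simp only [List.countP_cons, ih, decide_eq_true_eq, Bool.and_eq_true]
              rcases le_or_gt a x with h | h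
              · simp [h, hq a h, not_lt.2 h]; omega
              · simp [h, not_le.2 h]; omega
          have e1 := split (fun y => decide (y < v)) (by
            intro y hy; simpa using hy.trans_lt hv)
          have e2 := split (fun y => decide (y ≤ v)) (by
            intro y hy; simpa using (hy.trans_lt hv).le)
          refine ⟨?_, ?_⟩
          · omega
          · omega
      · intro i
        rw [(hrec i).2]
        have t1 := ihlot i
        have t2 := ihhit (i - l.countP (fun y => decide (y < x)) -
            l.countP (fun y => decide (y = x)))
        split_ifs with h1 h2
        · omega
        · simp only [Timed.ret_time]; omega
        · omega

end SelectionSpec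

/-! ## The greedy algorithm: invariants and running times -/

section GreedySpec

variable {X : Type u} [MetricSpace X] [DecidableEq X]

/-- The table of `σ` lists the vertices `V` with a nearest neighbor in `E` and the distance. -/
structure GreedyInv (V : List X) (σ : GreedyState X) : Prop where
  vertices : σ.table.map Entry.vertex = V
  nodup : σ.E.Nodup
  nearest_mem : ∀ e ∈ σ.table, e.nearest ∈ σ.E
  distE_eq : ∀ e ∈ σ.table, e.distE = dist e.vertex e.nearest
  distE_le : ∀ e ∈ σ.table, ∀ s ∈ σ.E, e.distE ≤ dist e.vertex s

omit [DecidableEq X] in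
theorem GreedyInv.table_length {V : List X} {σ : GreedyState X} (h : GreedyInv V σ) :
    σ.table.length = V.length := by
  rw [← h.vertices, List.length_map]

omit [DecidableEq X] in
theorem GreedyInv.length_le {V : List X} {σ : GreedyState X} (h : GreedyInv V σ)
    (hV : ∀ x, x ∈ V) : σ.E.length ≤ V.length :=
  (h.nodup.subperm fun x _ => hV x).length_le

omit [DecidableEq X] in
theorem GreedyInv.distE_nonneg {V : List X} {σ : GreedyState X} (h : GreedyInv V σ) :
    ∀ e ∈ σ.table, 0 ≤ e.distE := fun e he => by
  rw [h.distE_eq e he]; exact dist_nonneg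

omit [DecidableEq X] in
theorem GreedyInv.exists_entry {V : List X} {σ : GreedyState X} (h : GreedyInv V σ) {x : X}
    (hx : x ∈ V) : ∃ e ∈ σ.table, e.vertex = x := by
  rw [← h.vertices] at hx
  simpa using hx

omit [DecidableEq X] in
theorem greedyInv_initStateT (s : X) (V : List X) : GreedyInv V (initStateT s V).val where
  vertices := by simp [initStateT, Function.comp_def]
  nodup := by simp [initStateT]
  nearest_mem := by simp [initStateT]
  distE_eq := by simp [initStateT]
  distE_le := by simp [initStateT]

theorem addCenterT_val_of_mem {s : X} {σ : GreedyState X} (h : s ∈ σ.E) :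
    (addCenterT s σ).val = σ := by
  simp [addCenterT, h]

theorem addCenterT_val_of_notMem {s : X} {σ : GreedyState X} (h : s ∉ σ.E) :
    (addCenterT s σ).val = ⟨s :: σ.E, σ.table.map fun e : Entry X =>
      if dist e.vertex s < e.distE then ⟨e.vertex, s, dist e.vertex s⟩ else e⟩ := by
  simp [addCenterT, h]

theorem mem_addCenterT {s x : X} {σ : GreedyState X} :
    x ∈ (addCenterT s σ).val.E ↔ x = s ∨ x ∈ σ.E := by
  by_cases h : s ∈ σ.E
  · rw [addCenterT_val_of_mem h]
    constructor
    · exact Or.inr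
    · rintro (rfl | h') <;> assumption
  · rw [addCenterT_val_of_notMem h]; simp

theorem length_addCenterT_le (s : X) (σ : GreedyState X) :
    (addCenterT s σ).val.E.length ≤ σ.E.length + 1 := by
  by_cases h : s ∈ σ.E
  · rw [addCenterT_val_of_mem h]; omega
  · rw [addCenterT_val_of_notMem h]; simp

theorem GreedyInv.addCenterT {V : List X} {σ : GreedyState X} (hσ : GreedyInv V σ) (s : X) :
    GreedyInv V (addCenterT s σ).val := by
  by_cases h : s ∈ σ.E
  · rwa [addCenterT_val_of_mem h]
  · rw [addCenterT_val_of_notMem h]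
    refine ⟨?_, ?_, ?_, ?_, ?_⟩
    · rw [← hσ.vertices, List.map_map]
      refine List.map_congr_left fun e _ => ?_
      simp only [Function.comp]
      split_ifs <;> rfl
    · exact List.nodup_cons.2 ⟨h, hσ.nodup⟩
    · intro e' he'
      obtain ⟨e, he, rfl⟩ := List.mem_map.1 he'
      split_ifs
      · simp
      · exact List.mem_cons_of_mem _ (hσ.nearest_mem e he)
    · intro e' he'
      obtain ⟨e, he, rfl⟩ := List.mem_map.1 he'
      split_ifs
      · rfl
      · exact hσ.distE_eq e he
    · intro e' he' x hx
      obtain ⟨e, he, rfl⟩ := List.mem_map.1 he'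
      rcases List.mem_cons.1 hx with rfl | hx
      · split_ifs with h1
        · exact le_rfl
        · exact not_lt.1 h1
      · split_ifs with h1
        · exact h1.le.trans (hσ.distE_le e he x hx)
        · exact hσ.distE_le e he x hx

/-- The membership test scans `E`, which has no repetitions and hence at most `n` entries. -/
theorem GreedyInv.addCenterT_time_le {V : List X} {σ : GreedyState X} (hσ : GreedyInv V σ)
    (hV : ∀ x, x ∈ V) (s : X) : (_root_.addCenterT s σ).time ≤ 3 * V.length + 3 := by
  have h1 := hσ.length_le hV
  have h2 := memT_time_le s σ.E
  have h3 := hσ.table_length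
  by_cases h : s ∈ σ.E <;> simp [_root_.addCenterT, h] <;> omega

theorem addCentersT_cons_val (s : X) (ss : List X) (σ : GreedyState X) :
    (addCentersT (s :: ss) σ).val = (addCentersT ss (addCenterT s σ).val).val := rfl

theorem mem_addCentersT {ss : List X} {x : X} {σ : GreedyState X} :
    x ∈ (addCentersT ss σ).val.E ↔ x ∈ ss ∨ x ∈ σ.E := by
  induction ss generalizing σ with
  | nil => simp [addCentersT]
  | cons s ss ih => rw [addCentersT_cons_val, ih, mem_addCenterT, List.mem_cons]; tauto

theorem length_addCentersT_le (ss : List X) (σ : GreedyState X) :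
    (addCentersT ss σ).val.E.length ≤ σ.E.length + ss.length := by
  induction ss generalizing σ with
  | nil => simp [addCentersT]
  | cons s ss ih =>
    have := ih (addCenterT s σ).val
    have := length_addCenterT_le s σ
    rw [addCentersT_cons_val, List.length_cons]; omega

theorem GreedyInv.addCentersT {V : List X} {σ : GreedyState X} (hσ : GreedyInv V σ)
    (ss : List X) : GreedyInv V (addCentersT ss σ).val := by
  induction ss generalizing σ with
  | nil => exact hσ
  | cons s ss ih => exact ih (hσ.addCenterT s)

theorem GreedyInv.addCentersT_time_le {V : List X} {σ : GreedyState X} (hσ : GreedyInv V σ)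
    (hV : ∀ x, x ∈ V) (ss : List X) :
    (_root_.addCentersT ss σ).time ≤ ss.length * (3 * V.length + 4) + 1 := by
  induction ss generalizing σ with
  | nil => simp [_root_.addCentersT]
  | cons s ss ih =>
    have h1 := ih (hσ.addCenterT s)
    have h2 := hσ.addCenterT_time_le hV s
    simp only [_root_.addCentersT, Timed.tick_time, Timed.bind_time, List.length_cons]
    nlinarith

omit [MetricSpace X] [DecidableEq X] in
theorem pickT_val (a₀ : X) (l : List X) (is : List ℕ) :
    (pickT a₀ l is).val = is.map fun i => l.getD i a₀ := by
  induction is with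
  | nil => rfl
  | cons i is ih => simp [pickT, ih]

omit [MetricSpace X] [DecidableEq X] in
theorem pickT_time_le (a₀ : X) (l : List X) (is : List ℕ) :
    (pickT a₀ l is).time ≤ is.length * (l.length + 3) + 1 := by
  induction is with
  | nil => simp [pickT]
  | cons i is ih =>
    have := nthT_time_le a₀ l i
    simp only [pickT, Timed.tick_time, Timed.bind_time, List.length_cons, Timed.ret_time]
    nlinarith

omit [MetricSpace X] [DecidableEq X] in
theorem selectT_distE_spec (i : ℕ) (tab : List (Entry X)) (hi : i < tab.length) :
    tab.countP (fun e => decide (e.distE <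
        (selectT 0 tab.length (tab.map Entry.distE) i).val)) ≤ i ∧
      i < tab.countP (fun e => decide (e.distE ≤
        (selectT 0 tab.length (tab.map Entry.distE) i).val)) := by
  have := (selectT_spec (0 : ℝ) tab.length (tab.map Entry.distE) (by simp)).1 i (by simpa)
  simpa [IsOrderStat, List.countP_map, Function.comp_def] using this

omit [MetricSpace X] [DecidableEq X] in
theorem countP_distE_le_add (tab : List (Entry X)) (R : ℝ) :
    tab.countP (fun e => decide (e.distE ≤ R)) + tab.countP (fun e => decide (R < e.distE)) =
      tab.length := by
  have := (tab.map Entry.distE).countP_le_add_countP_gt R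
  simpa [List.countP_map, Function.comp_def] using this

omit [MetricSpace X] [DecidableEq X] in
theorem countP_distE_lt_add (tab : List (Entry X)) (R : ℝ) :
    tab.countP (fun e => decide (e.distE < R)) + tab.countP (fun e => decide (e.distE = R)) =
      tab.countP (fun e => decide (e.distE ≤ R)) := by
  have := (tab.map Entry.distE).countP_lt_add_countP_eq R
  simpa [List.countP_map, Function.comp_def] using this

omit [MetricSpace X] [DecidableEq X] in
theorem countP_distE_mono (tab : List (Entry X)) {r R : ℝ} (h : R < r) :
    tab.countP (fun e => decide (e.distE ≤ R)) ≤ tab.countP (fun e => decide (e.distE < r)) :=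
  List.countP_mono_left fun e _ he => by
    simp only [decide_eq_true_eq] at he ⊢; exact he.trans_lt h

omit [MetricSpace X] [DecidableEq X] in
theorem farthestT_val_of_lt {m : ℕ} {tab : List (Entry X)} (h : m < tab.length) :
    (farthestT tab.length m tab).val =
      (((tab.filter fun e => decide ((selectT 0 tab.length (tab.map Entry.distE)
          (tab.length - m)).val < e.distE)) ++
        (tab.filter fun e => decide (e.distE = (selectT 0 tab.length (tab.map Entry.distE)
          (tab.length - m)).val))).take m).map Entry.vertex := by
  simp [farthestT, not_le.2 h]

omit [MetricSpace X] [DecidableEq X] in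
-- The threshold has position `n - m` in increasing order, so at least `m` entries reach it; ties
-- are cut off by `take`. Positivity of `m` keeps this position inside the list.
theorem farthestT_length {m : ℕ} (hm : 0 < m) (tab : List (Entry X)) :
    (farthestT tab.length m tab).val.length = min m tab.length := by
  rcases le_or_gt tab.length m with h | h
  · simp [farthestT, h]
  · rw [farthestT_val_of_lt h]
    have h1 := selectT_distE_spec (tab.length - m) tab (by omega)
    have h2 := countP_distE_le_add tab (selectT 0 tab.length (tab.map Entry.distE)
          (tab.length - m)).val
    have h3 := countP_distE_lt_add tab (selectT 0 tab.length (tab.map Entry.distE)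
          (tab.length - m)).val
    simp only [List.length_map, List.length_take, List.length_append,
      ← List.countP_eq_length_filter]
    omega

omit [MetricSpace X] [DecidableEq X] in
theorem farthestT_nodup (m : ℕ) {tab : List (Entry X)} (hn : (tab.map Entry.vertex).Nodup) :
    (farthestT tab.length m tab).val.Nodup := by
  rcases le_or_gt tab.length m with h | h
  · simpa [farthestT, h] using hn
  · rw [farthestT_val_of_lt h]
    refine List.Nodup.sublist ((List.take_sublist _ _).map _) ?_
    rw [List.map_append, List.nodup_append']
    refine ⟨hn.sublist (List.filter_sublist.map _), hn.sublist (List.filter_sublist.map _), ?_⟩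
    intro x hx hx'
    obtain ⟨e, he, rfl⟩ := List.mem_map.1 hx
    obtain ⟨e', he', hee⟩ := List.mem_map.1 hx'
    obtain ⟨h1, h2⟩ := List.mem_filter.1 he
    obtain ⟨h1', h2'⟩ := List.mem_filter.1 he'
    have := List.inj_on_of_nodup_map hn h1' h1 hee
    subst this
    simp only [decide_eq_true_eq] at h2 h2'
    exact h2.ne' h2'

omit [MetricSpace X] [DecidableEq X] in
-- If more than `m` distances exceed `R`, the values up to `R` occupy fewer than `n - m` positions.
-- So the threshold at position `n - m` exceeds `R`, and no returned vertex is closer than the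
-- threshold.
theorem farthestT_far {m : ℕ} {tab : List (Entry X)} {R : ℝ}
    (hm : 0 < m) (hR : m < tab.countP fun e => decide (R < e.distE)) :
    ∀ x ∈ (farthestT tab.length m tab).val, ∃ e ∈ tab, e.vertex = x ∧ R < e.distE := by
  have h : m < tab.length := hR.trans_le List.countP_le_length
  rw [farthestT_val_of_lt h]
  have h1 := selectT_distE_spec (tab.length - m) tab (by omega)
  have h2 := countP_distE_le_add tab R
  have h4 : R < (selectT 0 tab.length (tab.map Entry.distE) (tab.length - m)).val := by
    by_contra hc
    have : tab.countP (fun e => decide (e.distE ≤ (selectT 0 tab.length (tab.map Entry.distE)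
        (tab.length - m)).val)) ≤ tab.countP (fun e => decide (e.distE ≤ R)) :=
      List.countP_mono_left fun e _ he => by
        simp only [decide_eq_true_eq] at he ⊢; exact he.trans (not_lt.1 hc)
    omega
  intro x hx
  obtain ⟨e, he, rfl⟩ := List.mem_map.1 hx
  rcases List.mem_append.1 (List.mem_of_mem_take he) with he | he
  · obtain ⟨h5, h6⟩ := List.mem_filter.1 he
    simp only [decide_eq_true_eq] at h6
    exact ⟨e, h5, rfl, h4.trans h6⟩
  · obtain ⟨h5, h6⟩ := List.mem_filter.1 he
    simp only [decide_eq_true_eq] at h6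
    exact ⟨e, h5, rfl, h6 ▸ h4⟩

omit [MetricSpace X] [DecidableEq X] in
theorem farthestT_time_le (m : ℕ) (tab : List (Entry X)) :
    (farthestT tab.length m tab).time ≤ 1100 * (tab.length + 1) := by
  rcases le_or_gt tab.length m with h | h
  · simp [farthestT, h]; omega
  · have h1 := (selectT_spec (0 : ℝ) tab.length (tab.map Entry.distE) (by simp)).2
      (tab.length - m)
    simp only [farthestT, not_le.2 h, if_false, Timed.bind_time, mapT_time, mapT_val,
      filterT_time, filterT_val, appendT_val, appendT_time, takeT_val, List.length_take,
      List.length_map] at h1 ⊢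
    set τ := (selectT 0 tab.length (tab.map Entry.distE) (tab.length - m)).val
    have h2 := takeT_time_le m ((tab.filter fun e => decide (τ < e.distE)) ++
      (tab.filter fun e => decide (e.distE = τ)))
    have h3 := List.length_filter_le (fun e => decide (τ < e.distE)) tab
    have h4 := List.length_filter_le (fun e => decide (e.distE = τ)) tab
    rw [List.length_append] at h2
    omega

omit [MetricSpace X] [DecidableEq X] in
theorem countP_radiusT_lt_le (m : ℕ) (tab : List (Entry X)) :
    tab.countP (fun e => decide ((radiusT tab.length m tab).val < e.distE)) ≤ m := by
  rcases le_or_gt tab.length m with h | h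
  · exact List.countP_le_length.trans h
  · have h1 := selectT_distE_spec (tab.length - 1 - m) tab (by omega)
    have h2 := countP_distE_le_add tab (selectT 0 tab.length (tab.map Entry.distE)
      (tab.length - 1 - m)).val
    simp only [radiusT, not_le.2 h, if_false, Timed.bind_val, mapT_val]
    omega

omit [MetricSpace X] [DecidableEq X] in
theorem radiusT_nonneg (m : ℕ) {tab : List (Entry X)} (hd : ∀ e ∈ tab, 0 ≤ e.distE) :
    0 ≤ (radiusT tab.length m tab).val := by
  rcases le_or_gt tab.length m with h | h
  · simp [radiusT, h]
  · have := (selectT_spec (0 : ℝ) tab.length (tab.map Entry.distE) (by simp)).1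
      (tab.length - 1 - m) (by rw [List.length_map]; omega)
    obtain ⟨e, he, h'⟩ := List.mem_map.1 this.mem
    simp only [radiusT, not_le.2 h, if_false, Timed.bind_val, mapT_val, ← h']
    exact hd e he

omit [MetricSpace X] [DecidableEq X] in
-- If at most `m` distances exceed `R`, at least `n - m` are at most `R`, and position `n - 1 - m`
-- is among them. The sign of `R` matters for the default radius `0`.
theorem radiusT_le {m : ℕ} {tab : List (Entry X)} {R : ℝ} (hR : 0 ≤ R)
    (hc : tab.countP (fun e => decide (R < e.distE)) ≤ m) :
    (radiusT tab.length m tab).val ≤ R := by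
  rcases le_or_gt tab.length m with h | h
  · simpa [radiusT, h]
  · have h1 := selectT_distE_spec (tab.length - 1 - m) tab (by omega)
    have h2 := countP_distE_le_add tab R
    simp only [radiusT, not_le.2 h, if_false, Timed.bind_val, mapT_val]
    by_contra! hlt
    have := countP_distE_mono tab hlt
    omega

omit [MetricSpace X] [DecidableEq X] in
theorem radiusT_time_le (m : ℕ) (tab : List (Entry X)) :
    (radiusT tab.length m tab).time ≤ 1100 * (tab.length + 1) := by
  rcases le_or_gt tab.length m with h | h
  · simp [radiusT, h]; omega
  · have h1 := (selectT_spec (0 : ℝ) tab.length (tab.map Entry.distE) (by simp)).2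
      (tab.length - 1 - m)
    simp only [radiusT, not_le.2 h, if_false, Timed.bind_time, mapT_time, mapT_val,
      List.length_map] at h1 ⊢
    omega

/-- One of the later rounds, with drawn positions `is`. -/
noncomputable def roundT (n z : ℕ) (a₀ : X) (σ : GreedyState X) (is : List ℕ) :
    Timed (GreedyState X) :=
  (farthestT n (2 * z) σ.table).bind fun Q => (pickT a₀ Q is).bind fun ss => addCentersT ss σ

/-- The fold is the form to which `card_rank_ne_zero_le` applies. -/
theorem roundsT_val (n z : ℕ) (a₀ : X) (L : List (List ℕ)) (σ : GreedyState X) :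
    (roundsT n z a₀ L σ).val = L.foldl (fun σ is => (roundT n z a₀ σ is).val) σ := by
  induction L generalizing σ with
  | nil => rfl
  | cons is L ih => simp only [roundsT, Timed.tick_val, Timed.bind_val, ih, List.foldl_cons, roundT]

theorem mem_roundT {n z : ℕ} {a₀ x : X} {σ : GreedyState X} {is : List ℕ} :
    x ∈ (roundT n z a₀ σ is).val.E ↔
      (∃ i ∈ is, (farthestT n (2 * z) σ.table).val.getD i a₀ = x) ∨ x ∈ σ.E := by
  simp only [roundT, Timed.bind_val, mem_addCentersT, pickT_val, List.mem_map]

theorem GreedyInv.roundT {V : List X} {σ : GreedyState X} (hσ : GreedyInv V σ) (n z : ℕ) (a₀ : X)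
    (is : List ℕ) : GreedyInv V (roundT n z a₀ σ is).val :=
  hσ.addCentersT _

theorem length_roundT_le (n z : ℕ) (a₀ : X) (σ : GreedyState X) (is : List ℕ) :
    (roundT n z a₀ σ is).val.E.length ≤ σ.E.length + is.length := by
  have := length_addCentersT_le (pickT a₀ (farthestT n (2 * z) σ.table).val is).val σ
  rw [show (pickT a₀ (farthestT n (2 * z) σ.table).val is).val.length = is.length by
    rw [pickT_val, List.length_map]] at this
  exact this

theorem GreedyInv.roundT_time_le {V : List X} {σ : GreedyState X} (hσ : GreedyInv V σ)
    (hV : ∀ x, x ∈ V) {z : ℕ} (hz : 0 < z) (a₀ : X) (is : List ℕ) :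
    (_root_.roundT V.length z a₀ σ is).time ≤ (1110 + 10 * is.length) * (V.length + 1) := by
  rw [_root_.roundT, ← hσ.table_length]
  have h1 := farthestT_time_le (2 * z) σ.table
  have h2 := farthestT_length (m := 2 * z) (by omega) σ.table
  have h3 := pickT_time_le a₀ (farthestT σ.table.length (2 * z) σ.table).val is
  have h4 := hσ.addCentersT_time_le hV
    (pickT a₀ (farthestT σ.table.length (2 * z) σ.table).val is).val
  have h5 : (farthestT σ.table.length (2 * z) σ.table).val.length ≤ σ.table.length := by omega
  rw [show (pickT a₀ (farthestT σ.table.length (2 * z) σ.table).val is).val.length = is.length by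
    rw [pickT_val, List.length_map], ← hσ.table_length] at h4
  simp only [Timed.bind_time]
  have h6 := Nat.mul_le_mul_left is.length (Nat.add_le_add_right h5 3)
  nlinarith

theorem GreedyInv.roundsT {V : List X} {σ : GreedyState X} (hσ : GreedyInv V σ) (n z : ℕ) (a₀ : X)
    (L : List (List ℕ)) : GreedyInv V (roundsT n z a₀ L σ).val := by
  induction L generalizing σ with
  | nil => exact hσ
  | cons is L ih => exact ih (hσ.roundT n z a₀ is)

theorem length_roundsT_le (n z : ℕ) (a₀ : X) {L : List (List ℕ)} {s : ℕ}
    (hL : ∀ is ∈ L, is.length = s) (σ : GreedyState X) :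
    (roundsT n z a₀ L σ).val.E.length ≤ σ.E.length + L.length * s := by
  rw [roundsT_val]
  induction L generalizing σ with
  | nil => simp
  | cons is L ih =>
    have h1 := ih (fun i hi => hL i (List.mem_cons_of_mem _ hi)) (roundT n z a₀ σ is).val
    have h2 := length_roundT_le n z a₀ σ is
    rw [hL is (by simp)] at h2
    rw [List.foldl_cons, List.length_cons]
    nlinarith

theorem GreedyInv.roundsT_time_le {V : List X} {σ : GreedyState X} (hσ : GreedyInv V σ)
    (hV : ∀ x, x ∈ V) {z : ℕ} (hz : 0 < z) (a₀ : X) {L : List (List ℕ)} {s : ℕ}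
    (hL : ∀ is ∈ L, is.length = s) :
    (_root_.roundsT V.length z a₀ L σ).time ≤
      L.length * ((1111 + 10 * s) * (V.length + 1)) + 1 := by
  induction L generalizing σ with
  | nil => simp [_root_.roundsT]
  | cons is L ih =>
    have h1 := ih (hσ.roundT V.length z a₀ is) (fun i hi => hL i (List.mem_cons_of_mem _ hi))
    have h2 := hσ.roundT_time_le hV hz a₀ is
    rw [hL is (by simp)] at h2
    have h3 : (_root_.roundsT V.length z a₀ (is :: L) σ).time =
        (_root_.roundT V.length z a₀ σ is).time +
        (_root_.roundsT V.length z a₀ L (_root_.roundT V.length z a₀ σ is).val).time + 1 := by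
      simp only [_root_.roundsT, _root_.roundT, Timed.tick_time, Timed.bind_time, Timed.bind_val]
      ring
    rw [h3, List.length_cons]
    nlinarith

/-- The state after a nonempty initial sample `ss`. -/
noncomputable def sampleState (V : List X) (s : X) (ss : List X) : GreedyState X :=
  (addCentersT ss (initStateT s V).val).val

theorem greedyInv_sampleState (V : List X) (s : X) (ss : List X) :
    GreedyInv V (sampleState V s ss) :=
  (greedyInv_initStateT s V).addCentersT ss

theorem mem_sampleState {V : List X} {s x : X} {ss : List X} :
    x ∈ (sampleState V s ss).E ↔ x ∈ s :: ss := by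
  rw [sampleState, mem_addCentersT, List.mem_cons]
  simp [initStateT, or_comm]

theorem length_sampleState_le (V : List X) (s : X) (ss : List X) :
    (sampleState V s ss).E.length ≤ (s :: ss).length := by
  have := length_addCentersT_le ss (initStateT s V).val
  simp only [initStateT, Timed.bind_val, Timed.ret_val, List.length_cons, List.length_nil] at this
  simp only [sampleState, initStateT, Timed.bind_val, Timed.ret_val, List.length_cons]
  omega

theorem greedyT_val (n z : ℕ) (a₀ : X) (V' : List X) (i : ℕ) (is : List ℕ)
    (later : List (List ℕ)) :
    (greedyT n z (a₀ :: V') (i :: is) later).val =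
      (roundsT n z a₀ later (sampleState (a₀ :: V') ((a₀ :: V').getD i a₀)
        (is.map fun i => (a₀ :: V').getD i a₀))).val := by
  have h := pickT_val a₀ (a₀ :: V') (i :: is)
  rw [List.map_cons] at h
  simp only [greedyT, Timed.bind_val]
  rw [h]
  rfl

theorem greedyT_time_le {z : ℕ} (hz : 0 < z) (a₀ : X) (V' : List X) (hV : ∀ x, x ∈ a₀ :: V')
    (i : ℕ) (is : List ℕ) {later : List (List ℕ)} {s : ℕ} (hL : ∀ is ∈ later, is.length = s) :
    (greedyT (a₀ :: V').length z (a₀ :: V') (i :: is) later).time ≤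
      (10 * (i :: is).length + 10 + later.length * (1111 + 10 * s)) *
        ((a₀ :: V').length + 1) := by
  have h := pickT_val a₀ (a₀ :: V') (i :: is)
  rw [List.map_cons] at h
  have h1 := pickT_time_le a₀ (a₀ :: V') (i :: is)
  have h2 := (greedyInv_initStateT ((a₀ :: V').getD i a₀) (a₀ :: V')).addCentersT_time_le hV
    (is.map fun i => (a₀ :: V').getD i a₀)
  have h3 := (greedyInv_sampleState (a₀ :: V') ((a₀ :: V').getD i a₀)
    (is.map fun i => (a₀ :: V').getD i a₀)).roundsT_time_le hV hz a₀ hL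
  have h4 : (initStateT ((a₀ :: V').getD i a₀) (a₀ :: V')).time = 2 * (a₀ :: V').length + 2 := by
    simp [initStateT]
  have h5 : (greedyT (a₀ :: V').length z (a₀ :: V') (i :: is) later).time =
      (pickT a₀ (a₀ :: V') (i :: is)).time +
      ((initStateT ((a₀ :: V').getD i a₀) (a₀ :: V')).time +
      ((addCentersT (is.map fun i => (a₀ :: V').getD i a₀)
        (initStateT ((a₀ :: V').getD i a₀) (a₀ :: V')).val).time +
      (roundsT (a₀ :: V').length z a₀ later (sampleState (a₀ :: V') ((a₀ :: V').getD i a₀)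
        (is.map fun i => (a₀ :: V').getD i a₀))).time)) := by
    simp only [greedyT, Timed.bind_time]
    rw [h]
    rfl
  rw [h5, h4]
  generalize (a₀ :: V').length = n at *
  simp only [List.length_map, List.length_cons] at *
  nlinarith

omit [MetricSpace X] in
theorem weightsT_val (near : List (Entry X)) (E : List X) :
    (weightsT near E).val = E.map fun q => (q, near.countP fun e => decide (e.nearest = q)) := by
  induction E with
  | nil => rfl
  | cons q E ih => simp [weightsT, ih]

omit [MetricSpace X] in
theorem weightsT_time (near : List (Entry X)) (E : List X) :
    (weightsT near E).time = E.length * (2 * near.length + 3) + 1 := by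
  induction E with
  | nil => simp [weightsT]
  | cons q E ih =>
    simp [weightsT, ih]; ring

end GreedySpec

/-! ## Adaptive sequences of trials -/

/-- The probability of fewer than `m` successes in `T` independent trials, each of which fails
with probability `η`. -/
noncomputable def failBound (η : ℝ) : ℕ → ℕ → ℝ
  | _, 0 => 0
  | 0, _ + 1 => 1
  | T + 1, m + 1 => (1 - η) * failBound η T m + η * failBound η T (m + 1)

theorem failBound_zero (η : ℝ) (T : ℕ) : failBound η T 0 = 0 := by
  cases T <;> rfl

theorem failBound_le_succ {η : ℝ} (h0 : 0 ≤ η) (h1 : η ≤ 1) (T m : ℕ) :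
    0 ≤ failBound η T m ∧ failBound η T m ≤ failBound η T (m + 1) := by
  induction T generalizing m with
  | zero => cases m <;> simp [failBound]
  | succ T ih =>
    cases m with
    | zero =>
      have h2 := ih 0
      simp only [failBound, failBound_zero] at h2 ⊢
      exact ⟨le_rfl, by nlinarith⟩
    | succ m =>
      have h2 := ih m
      have h3 := ih (m + 1)
      have h4 := ih (m + 2)
      simp only [failBound]
      constructor
      · nlinarith
      · nlinarith

theorem failBound_mono {η : ℝ} (h0 : 0 ≤ η) (h1 : η ≤ 1) (T : ℕ) : Monotone (failBound η T) :=
  monotone_nat_of_le_succ fun m => (failBound_le_succ h0 h1 T m).2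

/-- For the number `N` of successes, the indicator of `N < m` is at most `((m + v - N)/v)²`, and the
right side is the expectation of this square. It satisfies the recursion of `failBound` with
equality, so only the boundary values need an estimate. -/
theorem failBound_le_quadratic {η v : ℝ} (h0 : 0 ≤ η) (h1 : η ≤ 1) (hv : 0 < v) (T m : ℕ) :
    failBound η T m ≤ (T * (η * (1 - η)) + (T * (1 - η) - v - m) ^ 2) / v ^ 2 := by
  induction T generalizing m with
  | zero =>
    cases m with
    | zero => simp only [failBound]; positivity
    | succ m =>
      simp only [failBound]
      rw [le_div_iff₀ (by positivity)]
      push_cast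
      have : (0 : ℝ) ≤ m := m.cast_nonneg
      nlinarith
  | succ T ih =>
    have h2 : 0 ≤ 1 - η := by linarith
    cases m with
    | zero => simp only [failBound]; positivity
    | succ m =>
      simp only [failBound]
      have e1 := mul_le_mul_of_nonneg_left (ih m) h2
      have e2 := mul_le_mul_of_nonneg_left (ih (m + 1)) h0
      refine (add_le_add e1 e2).trans (le_of_eq ?_)
      rw [mul_div_assoc', mul_div_assoc', ← add_div]
      congr 1
      push_cast
      ring

/-- A one-sided Chebyshev bound for `failBound`. -/
theorem failBound_le_cantelli {η : ℝ} (h0 : 0 < η) (h1 : η < 1) {T m : ℕ}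
    (hm : (m : ℝ) < T * (1 - η)) :
    failBound η T m ≤ T * (η * (1 - η)) /
      (T * (η * (1 - η)) + (T * (1 - η) - m) ^ 2) := by
  have h2 : 0 < 1 - η := by linarith
  obtain ⟨δ, hδ⟩ : ∃ δ, δ = T * (1 - η) - m := ⟨_, rfl⟩
  obtain ⟨s, hs⟩ : ∃ s, s = T * (η * (1 - η)) := ⟨_, rfl⟩
  have hδ0 : 0 < δ := by rw [hδ]; linarith
  have hs0 : 0 ≤ s := by rw [hs]; positivity
  -- This shift `v` minimizes `(s + (δ - v)²)/v²`; the minimum is `s/(s + δ²)`.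
  have hv : 0 < (s + δ ^ 2) / δ := by positivity
  refine (failBound_le_quadratic h0.le h1.le hv T m).trans (le_of_eq ?_)
  rw [show (T * (1 - η) - (s + δ ^ 2) / δ - m : ℝ) = δ - (s + δ ^ 2) / δ by rw [hδ]; ring,
    ← hs, ← hδ]
  field_simp
  ring

/-- The expected number of successes exceeds `m` by some `δ ≥ √l ≥ 1`, and the variance is `η` times
that expectation. -/
theorem failBound_le_of_rounds {η l : ℝ} (h0 : 0 < η) (h1 : η < 1) (hl : 1 ≤ l) {T m : ℕ}
    (hm : (m : ℝ) ≤ l) (hT : (l + Real.sqrt l) / (1 - η) ≤ T) :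
    failBound η T m ≤ 1 - 1 / (1 + 2 * η) := by
  have h2 : 0 < 1 - η := by linarith
  rw [div_le_iff₀ h2] at hT
  have hs1 : 1 ≤ Real.sqrt l := Real.one_le_sqrt.2 hl
  have hs2 : Real.sqrt l ^ 2 = l := Real.sq_sqrt (by linarith)
  refine (failBound_le_cantelli h0 h1 (by linarith)).trans ?_
  obtain ⟨δ, hδ⟩ : ∃ δ, δ = T * (1 - η) - m := ⟨_, rfl⟩
  have hδs : Real.sqrt l ≤ δ := by rw [hδ]; linarith
  -- The left side is `m + δ`, where `m ≤ l ≤ δ²` and `δ ≤ δ²`.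
  have hW : T * (1 - η) ≤ 2 * δ ^ 2 := by nlinarith
  have hWp : 0 < T * (1 - η) := by linarith
  rw [← hδ, show T * (η * (1 - η)) = η * (T * (1 - η)) by ring]
  generalize T * (1 - η) = W at *
  have : 0 < δ := by linarith
  rw [show 1 - 1 / (1 + 2 * η) = 2 * η / (1 + 2 * η) by field_simp; ring,
    div_le_div_iff₀ (by positivity) (by positivity)]
  nlinarith [mul_le_mul_of_nonneg_left hW h0.le]

/-- Conditioning on one draw: the right side has the shape of the recursion of `failBound`. The
hypothesis `a ≤ b` lets the share of bad draws be raised to `η`. -/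
theorem sum_le_of_card_bad_le {D : Type*} [Fintype D] {f : D → ℝ} {bad : D → Prop}
    [DecidablePred bad] {a b η : ℝ} (hab : a ≤ b) (hb : ∀ d, f d ≤ b)
    (ha : ∀ d, ¬ bad d → f d ≤ a)
    (hbad : ((Finset.univ.filter bad).card : ℝ) ≤ η * Fintype.card D) :
    ∑ d, f d ≤ ((1 - η) * a + η * b) * Fintype.card D := by
  have h1 : ∑ d, f d ≤ ∑ d, (a + (b - a) * if bad d then 1 else 0) := by
    refine Finset.sum_le_sum fun d _ => ?_
    split_ifs with h
    · linarith [hb d]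
    · linarith [ha d h]
  rw [Finset.sum_add_distrib, ← Finset.mul_sum, Finset.sum_boole, Finset.sum_const,
    Finset.card_univ, nsmul_eq_mul] at h1
  have := mul_le_mul_of_nonneg_left hbad (sub_nonneg.2 hab)
  linarith

open Classical in
/-- If every step keeps the rank or lowers it, the latter with probability at least `1 - η`, then
the rank is positive after `T` steps with probability at most `failBound η T`. -/
theorem card_rank_ne_zero_le {S D : Type*} [Fintype D] {η : ℝ} (h0 : 0 ≤ η) (h1 : η ≤ 1)
    (step : S → D → S) (I : S → Prop) (rank : S → ℕ) (hI : ∀ s d, I s → I (step s d))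
    (hle : ∀ s d, I s → rank (step s d) ≤ rank s)
    (hlt : ∀ s, I s → rank s ≠ 0 →
      ((Finset.univ.filter fun d => rank s ≤ rank (step s d)).card : ℝ) ≤ η * Fintype.card D)
    (T : ℕ) (s : S) (hs : I s) :
    ((Finset.univ.filter fun ω : Fin T → D =>
      rank ((List.ofFn ω).foldl step s) ≠ 0).card : ℝ) ≤
      failBound η T (rank s) * (Fintype.card D : ℝ) ^ T := by
  induction T generalizing s with
  | zero =>
    rcases Nat.eq_zero_or_pos (rank s) with h | h
    · simp [h, failBound]
    · obtain ⟨m, hm⟩ := Nat.exists_eq_succ_of_ne_zero h.ne'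
      simp [hm, failBound]
  | succ T ih =>
    -- Split according to the outcome of the first step.
    have key : ((Finset.univ.filter fun ω : Fin (T + 1) → D =>
        rank ((List.ofFn ω).foldl step s) ≠ 0).card : ℝ) =
        ∑ d, ((Finset.univ.filter fun ω : Fin T → D =>
          rank ((List.ofFn ω).foldl step (step s d)) ≠ 0).card : ℝ) := by
      simp only [← Finset.sum_boole]
      rw [← (Fin.consEquiv fun _ : Fin (T + 1) => D).sum_comp, Fintype.sum_prod_type]
      simp [Fin.consEquiv, List.ofFn_succ]
    rw [key]
    have mono := failBound_mono h0 h1 T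
    rcases Nat.eq_zero_or_pos (rank s) with h | h
    · have : ∀ d, ((Finset.univ.filter fun ω : Fin T → D =>
          rank ((List.ofFn ω).foldl step (step s d)) ≠ 0).card : ℝ) ≤ 0 := by
        intro d
        have h2 := ih (step s d) (hI s d hs)
        rwa [Nat.le_zero.1 ((hle s d hs).trans h.le), failBound_zero, zero_mul] at h2
      rw [h, failBound_zero, zero_mul]
      exact Finset.sum_nonpos fun d _ => this d
    · obtain ⟨m, hm⟩ := Nat.exists_eq_succ_of_ne_zero h.ne'
      have hD : (0 : ℝ) ≤ (Fintype.card D : ℝ) ^ T := by positivity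
      have := sum_le_of_card_bad_le
        (a := failBound η T m * (Fintype.card D : ℝ) ^ T)
        (b := failBound η T (m + 1) * (Fintype.card D : ℝ) ^ T)
        (mul_le_mul_of_nonneg_right (mono m.le_succ) hD)
        (fun d => (ih (step s d) (hI s d hs)).trans
          (mul_le_mul_of_nonneg_right (mono ((hle s d hs).trans hm.le)) hD))
        (fun d hd => (ih (step s d) (hI s d hs)).trans
          (mul_le_mul_of_nonneg_right (mono (by omega)) hD))
        (hlt s hs h.ne')
      refine this.trans (le_of_eq ?_)
      rw [hm]
      simp only [failBound]
      ring

/-- Independent uniform draws all miss a set of density at least `1 - q` with probability at most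
`q ^ s`. -/
theorem card_forall_not_le {D : Type*} [Fintype D] {q : ℝ} (P : D → Prop)
    [DecidablePred P] (h : ((Finset.univ.filter fun d => ¬ P d).card : ℝ) ≤ q * Fintype.card D)
    (s : ℕ) :
    ((Finset.univ.filter fun ω : Fin s → D => ∀ i, ¬ P (ω i)).card : ℝ) ≤
      q ^ s * Fintype.card (Fin s → D) := by
  have : (Finset.univ.filter fun ω : Fin s → D => ∀ i, ¬ P (ω i)) =
      Fintype.piFinset fun _ : Fin s => Finset.univ.filter fun d => ¬ P d := by
    ext ω; simp
  rw [this, Fintype.card_piFinset_const, Fintype.card_fun, Fintype.card_fin]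
  push_cast
  rw [← mul_pow]
  exact pow_le_pow_left₀ (by positivity) h s

/-- From `q ≤ exp(-(1 - q))`. Both sample sizes of the algorithm are chosen to meet this hypothesis.
-/
theorem pow_le_of_log_le {η q : ℝ} (h0 : 0 < η) (hq0 : 0 ≤ q) {s : ℕ}
    (hs : Real.log (1 / η) ≤ (1 - q) * s) : q ^ s ≤ η := by
  have h1 : q ≤ Real.exp (-(1 - q)) := by
    have := Real.add_one_le_exp (-(1 - q)); linarith
  calc q ^ s ≤ Real.exp (-(1 - q)) ^ s := pow_le_pow_left₀ hq0 h1 s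
    _ = Real.exp (-((1 - q) * s)) := by rw [← Real.exp_nat_mul]; ring_nf
    _ ≤ Real.exp (-Real.log (1 / η)) := Real.exp_le_exp.2 (by linarith)
    _ = η := by rw [one_div, Real.log_inv, neg_neg, Real.exp_log h0]

theorem half_pow_roundSize_le {η : ℝ} (h0 : 0 < η) : (1 / 2 : ℝ) ^ roundSize η ≤ η := by
  refine pow_le_of_log_le h0 (by norm_num) ?_
  have : 2 * Real.log (1 / η) ≤ roundSize η := Nat.le_ceil _
  linarith

theorem pow_initialSize_le {η : ℝ} (h0 : 0 < η) {n z : ℕ} (hz : z < n) :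
    ((z : ℝ) / n) ^ initialSize n z η ≤ η := by
  have hn : (0 : ℝ) < n := by exact_mod_cast (Nat.zero_le z).trans_lt hz
  have h1 : 0 < 1 - (z : ℝ) / n := by
    rw [sub_pos, div_lt_one hn]; exact_mod_cast hz
  refine pow_le_of_log_le h0 (by positivity) ?_
  have : 1 / (1 - (z : ℝ) / n) * Real.log (1 / η) ≤ initialSize n z η := Nat.le_ceil _
  calc Real.log (1 / η) = (1 - (z : ℝ) / n) * (1 / (1 - (z : ℝ) / n) * Real.log (1 / η)) := by
        rw [← mul_assoc, mul_one_div_cancel h1.ne', one_mul]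
    _ ≤ _ := mul_le_mul_of_nonneg_left this h1.le

/-! ## Costs and coresets -/

section Cost

variable {X : Type u} [MetricSpace X]

theorem clusterCost_nonneg (S A : Finset X) : 0 ≤ clusterCost S A :=
  Real.iSup_nonneg fun _ => Metric.infDist_nonneg

theorem infDist_le_clusterCost {S : Finset X} (A : Finset X) {p : X} (hp : p ∈ S) :
    Metric.infDist p (A : Set X) ≤ clusterCost S A :=
  le_ciSup (f := fun p : S => Metric.infDist (p : X) (A : Set X)) (Set.finite_range _).bddAbove
    ⟨p, hp⟩

theorem clusterCost_le {S A : Finset X} {r : ℝ} (hr : 0 ≤ r)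
    (h : ∀ p ∈ S, Metric.infDist p (A : Set X) ≤ r) : clusterCost S A ≤ r :=
  Real.iSup_le (fun p => h p p.2) hr

theorem exists_dist_le_clusterCost {S A : Finset X} (hA : A.Nonempty) {p : X} (hp : p ∈ S) :
    ∃ a ∈ A, dist p a ≤ clusterCost S A := by
  obtain ⟨a, ha, h⟩ := A.finite_toSet.isCompact.exists_infDist_eq_dist hA p
  exact ⟨a, ha, h ▸ infDist_le_clusterCost A hp⟩

variable [DecidableEq X]

theorem phi_le {z : ℕ} {S : Finset X} {w : X → ℝ≥0} {H S' : Finset X} (hS : S' ⊆ S)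
    (hw : ∑ q ∈ S \ S', w q ≤ (z : ℝ≥0)) : phi z S w H ≤ clusterCost S' H :=
  csInf_le ⟨0, by rintro _ ⟨T, _, _, rfl⟩; exact clusterCost_nonneg T H⟩ ⟨S', hS, hw, rfl⟩

theorem le_phi {z : ℕ} {S : Finset X} {w : X → ℝ≥0} {H : Finset X} {r : ℝ}
    (h : ∀ S' ⊆ S, ∑ q ∈ S \ S', w q ≤ (z : ℝ≥0) → r ≤ clusterCost S' H) : r ≤ phi z S w H :=
  le_csInf ⟨_, S, Finset.Subset.refl S, by simp, rfl⟩ (by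
    rintro _ ⟨T, hT, hw, rfl⟩; exact h T hT hw)

/-- Moving every vertex by at most `R`, with weights counting the vertices moved to each place,
changes the costs by at most `R`. -/
theorem phi_abs_sub_le [Fintype X] {z : ℕ} {S : Finset X} {w : X → ℝ≥0} {R : ℝ} (hR : 0 ≤ R)
    (f : X → X) (hf : ∀ p, f p ∈ S) (hd : ∀ p, dist p (f p) ≤ R)
    (hw : ∀ q, w q = ((Finset.univ.filter fun p => f p = q).card : ℝ≥0)) (H : Finset X) :
    |phi z S w H - phi z Finset.univ (fun _ => 1) H| ≤ R := by
  -- The weight of a set is the number of points moved into it.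
  have hsum : ∀ T : Finset X, ∑ q ∈ T, w q = ((Finset.univ.filter fun p => f p ∈ T).card : ℝ≥0) := by
    intro T
    rw [Finset.sum_congr rfl fun q _ => hw q, ← Nat.cast_sum]
    rw [Finset.card_eq_sum_card_fiberwise (f := f) (t := T) (by intro p hp; simpa using hp)]
    congr 1
    refine Finset.sum_congr rfl fun q hq => ?_
    congr 1
    ext p
    simp only [Finset.mem_filter, Finset.mem_univ, true_and]
    constructor
    · rintro rfl; exact ⟨hq, rfl⟩
    · exact fun h => h.2
  rw [abs_sub_le_iff]
  constructor
  · rw [sub_le_iff_le_add, ← sub_le_iff_le_add']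
    refine le_phi fun X' _ hX' => ?_
    rw [sub_le_iff_le_add']
    -- A point moved outside the image of `X'` cannot belong to `X'`, so no more weight is discarded
    -- than before.
    refine (phi_le (S' := X'.image f) ?_ ?_).trans ?_
    · intro q hq
      obtain ⟨p, _, rfl⟩ := Finset.mem_image.1 hq
      exact hf p
    · rw [hsum]
      rw [Finset.sum_const, nsmul_eq_mul, mul_one] at hX'
      refine le_trans ?_ hX'
      exact_mod_cast Finset.card_le_card fun p hp => by
        simp only [Finset.mem_filter, Finset.mem_univ, true_and, Finset.mem_sdiff,
          Finset.mem_image, not_exists, not_and] at hp ⊢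
        exact fun hpX => hp.2 p hpX rfl
    · refine clusterCost_le (add_nonneg hR (clusterCost_nonneg _ _)) fun q hq => ?_
      obtain ⟨p, hp, rfl⟩ := Finset.mem_image.1 hq
      have h1 := Metric.infDist_le_infDist_add_dist (s := (H : Set X)) (x := f p) (y := p)
      have h2 := infDist_le_clusterCost H hp
      have h3 := hd p
      rw [dist_comm] at h3
      linarith
  · rw [sub_le_iff_le_add, ← sub_le_iff_le_add']
    refine le_phi fun S' _ hS' => ?_
    rw [sub_le_iff_le_add']
    -- For the other direction, keep the preimage of `S'`: the discarded points are those moved to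
    -- discarded places.
    refine (phi_le (S' := Finset.univ.filter fun p => f p ∈ S') (Finset.subset_univ _) ?_).trans ?_
    · rw [hsum] at hS'
      rw [Finset.sum_const, nsmul_eq_mul, mul_one]
      refine le_trans ?_ hS'
      exact_mod_cast Finset.card_le_card fun p hp => by
        simp only [Finset.mem_filter, Finset.mem_univ, true_and, Finset.mem_sdiff] at hp ⊢
        exact ⟨hf p, hp⟩
    · refine clusterCost_le (add_nonneg hR (clusterCost_nonneg _ _)) fun p hp => ?_
      have h1 := Metric.infDist_le_infDist_add_dist (s := (H : Set X)) (x := p) (y := f p)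
      have h2 := infDist_le_clusterCost H (Finset.mem_filter.1 hp).2
      have h3 := hd p
      linarith

/-- The additive error of `phi_abs_sub_le` becomes relative: leaving out at most `z` points and
using the centers `H` is a feasible solution, so the optimal cost is at most `φ₀(X, H)`. -/
theorem isCoreset_of_map [Fintype X] {μ : ℝ} (hμ : 0 ≤ μ) {k z : ℕ}
    {Xopt A : Finset X} (hopt : IsOptimalSolution k z Xopt A) {S : Finset X} {w : X → ℝ≥0}
    (f : X → X) (hf : ∀ p, f p ∈ S) (hd : ∀ p, dist p (f p) ≤ μ * clusterCost Xopt A)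
    (hw : ∀ q, w q = ((Finset.univ.filter fun p => f p = q).card : ℝ≥0)) :
    IsCoreset μ k z S w := by
  intro H hH
  have h1 := abs_sub_le_iff.1 (phi_abs_sub_le (z := z)
    (mul_nonneg hμ (clusterCost_nonneg Xopt A)) f hf hd hw H)
  have h2 : clusterCost Xopt A ≤ phi z Finset.univ (fun _ => 1) H := by
    refine le_phi fun Y _ hY => hopt.2.2 Y H ?_ hH
    rw [Finset.sum_const, nsmul_eq_mul, mul_one] at hY
    have hY' : (Finset.univ \ Y).card ≤ z := by exact_mod_cast hY
    rw [← Finset.compl_eq_univ_sdiff, Finset.card_compl] at hY'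
    omega
  have h3 := mul_le_mul_of_nonneg_left h2 hμ
  constructor <;> linarith [h1.1, h1.2]

omit [DecidableEq X] in
/-- Iterating the doubling property. -/
theorem DoublingDimLE.exists_cover {S : Finset X} {ρ : ℝ} (h : DoublingDimLE S ρ) {p : X}
    (hp : p ∈ S) (i : ℕ) {r : ℝ} (hr : 0 ≤ r) :
    ∃ B ⊆ S, (B.card : ℝ) ≤ ((2 : ℝ) ^ ρ) ^ i ∧
      ∀ q ∈ S, dist q p ≤ 2 ^ i * r → ∃ b ∈ B, dist q b ≤ r := by
  classical
  induction i generalizing r with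
  | zero => exact ⟨{p}, by simpa using hp, by simp, by simp⟩
  | succ i ih =>
    -- Cover by balls of radius `2r` first, then split each of them once more. Their centers lie in
    -- `S`, which the doubling property requires.
    obtain ⟨B, hBS, hBc, hB⟩ := ih (r := 2 * r) (by positivity)
    choose! C hCS hCc hC using fun b (hb : b ∈ B) => h b (hBS hb) r hr
    refine ⟨B.biUnion C, Finset.biUnion_subset.2 hCS, ?_, fun q hq hqp => ?_⟩
    · calc ((B.biUnion C).card : ℝ) ≤ ∑ b ∈ B, ((C b).card : ℝ) := by
            exact_mod_cast Finset.card_biUnion_le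
        _ ≤ ∑ b ∈ B, (2 : ℝ) ^ ρ := Finset.sum_le_sum hCc
        _ = B.card * (2 : ℝ) ^ ρ := by rw [Finset.sum_const, nsmul_eq_mul]
        _ ≤ _ := by
            rw [pow_succ]; exact mul_le_mul_of_nonneg_right hBc (by positivity)
    · obtain ⟨b, hb, hqb⟩ := hB q hq (by rw [pow_succ] at hqp; linarith)
      obtain ⟨c, hc, hqc⟩ := hC b hb q hq hqb
      exact ⟨c, Finset.mem_biUnion.2 ⟨b, hb, hc⟩, hqc⟩

theorem two_rpow_pow (ρ : ℝ) (i : ℕ) : ((2 : ℝ) ^ ρ) ^ i = ((2 : ℝ) ^ i) ^ ρ := by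
  rw [← Real.rpow_natCast, ← Real.rpow_mul (by norm_num), mul_comm,
    Real.rpow_mul (by norm_num), Real.rpow_natCast]

omit [DecidableEq X] in
theorem exists_cover_of_cover_clusters {Xopt A : Finset X} (hA : A.Nonempty) {r K : ℝ}
    (h : ∀ a ∈ A, ∃ B : Finset X, (B.card : ℝ) ≤ K ∧
      ∀ q ∈ Xopt, dist q a ≤ clusterCost Xopt A → ∃ b ∈ B, dist q b ≤ r) :
    ∃ B : Finset X, (B.card : ℝ) ≤ K * A.card ∧ ∀ q ∈ Xopt, ∃ b ∈ B, dist q b ≤ r := by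
  classical
  choose! B hBc hB using h
  refine ⟨A.biUnion B, ?_, fun q hq => ?_⟩
  · calc ((A.biUnion B).card : ℝ) ≤ ∑ a ∈ A, ((B a).card : ℝ) := by
          exact_mod_cast Finset.card_biUnion_le
      _ ≤ ∑ a ∈ A, K := Finset.sum_le_sum hBc
      _ = _ := by rw [Finset.sum_const, nsmul_eq_mul, mul_comm]
  · obtain ⟨a, ha, hqa⟩ := exists_dist_le_clusterCost hA hq
    obtain ⟨b, hb, hqb⟩ := hB a ha q hq hqa
    exact ⟨b, Finset.mem_biUnion.2 ⟨a, ha, hb⟩, hqb⟩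

omit [DecidableEq X] in
/-- The inliers are covered by at most `κ (2 / μ) ^ ρ k` balls of diameter `μ` times the optimal
radius. -/
theorem exists_inlier_cover {Xopt A : Finset X} {μ ρ κ : ℝ} (hA : A.Nonempty) (hμ0 : 0 < μ)
    (hμ1 : μ < 1) (hρ : 0 < ρ) (hdim : DoublingDimLE Xopt ρ)
    (hκ : κ = 4 ^ ρ ∨ (κ = 1 ∧ A ⊆ Xopt ∧ ∃ i : ℕ, μ = 1 / 2 ^ i)) :
    ∃ B : Finset X, (B.card : ℝ) ≤ κ * (2 / μ) ^ ρ * A.card ∧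
      ∀ q ∈ Xopt, ∃ b ∈ B, dist q b ≤ μ * clusterCost Xopt A / 2 := by
  have hr := clusterCost_nonneg Xopt A
  obtain ⟨r, hr'⟩ : ∃ r, r = clusterCost Xopt A := ⟨_, rfl⟩
  refine exists_cover_of_cover_clusters hA fun a ha => ?_
  rw [← hr'] at hr ⊢
  rcases hκ with rfl | ⟨rfl, hAX, i, rfl⟩
  -- The center `a` need not be an inlier, so the doubling property is used at an inlier `p` of its
  -- cluster; the cluster lies within `2r` of `p`.
  · by_cases hne : ∃ p ∈ Xopt, dist p a ≤ r
    · obtain ⟨p, hp, hpa⟩ := hne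
      -- With `2^j ≤ 4/μ < 2^(j+1)`, halving `j + 1` times brings the radius from `2r` to `μr/2`.
      -- The number of balls is at most `(8/μ)^ρ = 4^ρ (2/μ)^ρ`.
      obtain ⟨j, hj1, hj2⟩ := exists_nat_pow_near (x := 4 / μ) (y := (2 : ℝ))
        (by rw [le_div_iff₀ hμ0]; linarith) (by norm_num)
      obtain ⟨B, -, hBc, hB⟩ := hdim.exists_cover hp (j + 1) (r := μ * r / 2) (by positivity)
      refine ⟨B, hBc.trans ?_, fun q hq hqa => hB q hq ?_⟩
      · rw [two_rpow_pow, ← Real.mul_rpow (by norm_num) (by positivity)]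
        refine Real.rpow_le_rpow (by positivity) ?_ hρ.le
        rw [pow_succ]
        calc (2 : ℝ) ^ j * 2 ≤ 4 / μ * 2 := by linarith
          _ = 4 * (2 / μ) := by ring
      · have h1 : dist q p ≤ 2 * r := by
          have := dist_triangle q a p
          rw [dist_comm a p] at this
          linarith
        have h2 : 2 * r = 4 / μ * (μ * r / 2) := by field_simp; ring
        rw [h2] at h1
        exact h1.trans (mul_le_mul_of_nonneg_right hj2.le (by positivity))
    · refine ⟨∅, ?_, fun q hq hqa => (hne ⟨q, hq, hqa⟩).elim⟩
      rw [Finset.card_empty, Nat.cast_zero]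
      positivity
  -- Here `a` is an inlier and `i + 1` halvings lead from `r` to `μr/2` without rounding, so the
  -- factor `4^ρ` is not needed.
  · obtain ⟨B, -, hBc, hB⟩ := hdim.exists_cover (hAX ha) (i + 1) (r := 1 / 2 ^ i * r / 2)
      (by positivity)
    refine ⟨B, hBc.trans (le_of_eq ?_), fun q hq hqa => hB q hq (hqa.trans (le_of_eq ?_))⟩
    · rw [two_rpow_pow, one_mul, pow_succ]
      congr 1
      field_simp
    · field_simp
      ring

end Cost

/-! ## The output of the construction -/

section Output

variable {X : Type u} [MetricSpace X] [DecidableEq X]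

/-- The weighted set that is built from the final state of the greedy algorithm. -/
noncomputable def coresetOutput (m : ℕ) (σ : GreedyState X) : List (X × ℕ) :=
  (σ.E.map fun q => (q, (σ.table.filter fun e =>
    decide (e.distE ≤ (radiusT σ.table.length m σ.table).val)).countP
      fun e => decide (e.nearest = q))) ++
  (σ.table.filter fun e => decide ((radiusT σ.table.length m σ.table).val < e.distE)).map
    fun e => (e.vertex, 1)

omit [MetricSpace X] in
theorem outSet_coresetOutput (m : ℕ) (σ : GreedyState X) :
    outSet (coresetOutput m σ) = σ.E.toFinset ∪ ((σ.table.filter fun e =>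
      decide ((radiusT σ.table.length m σ.table).val < e.distE)).map Entry.vertex).toFinset := by
  simp [outSet, coresetOutput, Function.comp_def]

omit [MetricSpace X] in
theorem card_outSet_coresetOutput_le (m : ℕ) (σ : GreedyState X) :
    (outSet (coresetOutput m σ)).card ≤ σ.E.length + m := by
  rw [outSet_coresetOutput]
  refine (Finset.card_union_le _ _).trans (add_le_add (List.toFinset_card_le _) ?_)
  refine (List.toFinset_card_le _).trans ?_
  rw [List.length_map, ← List.countP_eq_length_filter]
  exact countP_radiusT_lt_le m σ.table

omit [MetricSpace X] [DecidableEq X] in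
theorem countP_filter_add_countP_filter (l : List (Entry X)) (r : ℝ) (a b : Entry X → Bool) :
    (l.filter fun e => decide (e.distE ≤ r)).countP a +
      (l.filter fun e => decide (r < e.distE)).countP b =
      l.countP fun e => if e.distE ≤ r then a e else b e := by
  induction l with
  | nil => rfl
  | cons e l ih =>
    rw [List.countP_cons (a := e) (l := l), ← ih]
    rcases le_or_gt e.distE r with h | h
    · simp [h, not_lt.2 h, List.countP_cons]; omega
    · simp [h, not_le.2 h, List.countP_cons]; omega

omit [MetricSpace X] in
-- Each row of the table is counted once, at its nearest selected vertex or at itself. This presents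
-- the weights as fiber sizes, as `isCoreset_of_map` requires. Repetitions in `E` would count rows
-- twice.
theorem outWeight_coresetOutput (m : ℕ) {σ : GreedyState X} (hn : σ.E.Nodup)
    (hE : ∀ e ∈ σ.table, e.nearest ∈ σ.E) (q : X) :
    outWeight (coresetOutput m σ) q = ((σ.table.countP fun e =>
      if e.distE ≤ (radiusT σ.table.length m σ.table).val then decide (e.nearest = q)
        else decide (e.vertex = q) : ℕ) : ℝ≥0) := by
  rw [outWeight, ← countP_filter_add_countP_filter, coresetOutput]
  congr 1
  rw [List.filter_append, List.map_append, List.sum_append, List.filter_map, List.filter_map,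
    List.map_map, List.map_map]
  congr 1
  · simp only [Function.comp_def]
    rw [List.filter_eq, List.map_replicate, List.sum_replicate, smul_eq_mul]
    by_cases hq : q ∈ σ.E
    · rw [List.count_eq_one_of_mem hn hq, one_mul]
    · rw [List.count_eq_zero_of_not_mem hq, zero_mul, eq_comm, List.countP_eq_zero]
      intro e he
      simp only [decide_eq_true_eq]
      rintro rfl
      exact hq (hE e (List.mem_of_mem_filter he))
  · simp [Function.comp_def, List.countP_eq_length_filter]

/-- The map sends a vertex within the radius to its stored nearest neighbor and fixes the others, so
no vertex moves by more than the radius. -/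
theorem GreedyInv.isCoreset [Fintype X] {V : List X} {σ : GreedyState X} (hσ : GreedyInv V σ)
    (hn : V.Nodup) (hV : ∀ x, x ∈ V) {μ : ℝ} (hμ : 0 ≤ μ) {k z m : ℕ} {Xopt A : Finset X}
    (hopt : IsOptimalSolution k z Xopt A)
    (hr : (radiusT σ.table.length m σ.table).val ≤ μ * clusterCost Xopt A) :
    IsCoreset μ k z (outSet (coresetOutput m σ)) (outWeight (coresetOutput m σ)) := by
  choose ent hent hentv using fun x => hσ.exists_entry (hV x)
  have hn' : (σ.table.map Entry.vertex).Nodup := hσ.vertices ▸ hn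
  have hent' : ∀ e ∈ σ.table, ent e.vertex = e := fun e he =>
    List.inj_on_of_nodup_map hn' (hent _) he (hentv _)
  set r := (radiusT σ.table.length m σ.table).val with hrdef
  have hr0 : 0 ≤ r := radiusT_nonneg m hσ.distE_nonneg
  refine isCoreset_of_map hμ hopt
    (fun p => if (ent p).distE ≤ r then (ent p).nearest else p) ?_ ?_ ?_
  · intro p
    rw [outSet_coresetOutput, Finset.mem_union, List.mem_toFinset, List.mem_toFinset]
    split_ifs with h
    · exact Or.inl (hσ.nearest_mem _ (hent p))
    · refine Or.inr (List.mem_map.2 ⟨ent p, List.mem_filter.2 ⟨hent p, ?_⟩, hentv p⟩)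
      simpa using h
  · intro p
    split_ifs with h
    · have := hσ.distE_eq _ (hent p)
      rw [hentv] at this
      exact this ▸ h.trans hr
    · rw [dist_self]; exact hr0.trans hr
  · intro q
    rw [outWeight_coresetOutput m hσ.nodup hσ.nearest_mem]
    congr 1
    have h1 : (Finset.univ.filter fun p => (if (ent p).distE ≤ r then (ent p).nearest else p) = q)
        = (V.filter fun p =>
          decide ((if (ent p).distE ≤ r then (ent p).nearest else p) = q)).toFinset := by
      ext p; simp [hV]
    rw [h1, List.toFinset_card_of_nodup (hn.filter _), ← List.countP_eq_length_filter]
    conv_rhs => rw [← hσ.vertices]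
    rw [List.countP_map]
    refine List.countP_congr fun e he => ?_
    simp only [Function.comp, hent' e he, ← hrdef]
    split_ifs <;> simp

theorem initialSize_pos {η : ℝ} (h0 : 0 < η) (h1 : η < 1) {n z : ℕ} (hz : z < n) :
    0 < initialSize n z η := by
  have hn : (0 : ℝ) < n := by exact_mod_cast (Nat.zero_le z).trans_lt hz
  have h2 : 0 < 1 - (z : ℝ) / n := by
    rw [sub_pos, div_lt_one hn]; exact_mod_cast hz
  refine Nat.ceil_pos.2 (mul_pos (by positivity) (Real.log_pos ?_))
  rw [lt_div_iff₀ h0]; linarith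

/-- The state of the greedy algorithm after the draws `ω`. -/
theorem exists_greedyT_eq {V : List X} {a₀ : X} (hhead : ∃ V', V = a₀ :: V') (hV : ∀ x, x ∈ V) :
    ∃ init : List ℕ → GreedyState X, ∀ first, first ≠ [] →
      GreedyInv V (init first) ∧
      (∀ x, x ∈ (init first).E ↔ ∃ i ∈ first, V.getD i a₀ = x) ∧
      (init first).E.length ≤ first.length ∧
      ∀ z later, (greedyT V.length z V first later).val =
          (roundsT V.length z a₀ later (init first)).val ∧
        ∀ s, 0 < z → (∀ is ∈ later, is.length = s) →
          (greedyT V.length z V first later).time ≤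
            (10 * first.length + 10 + later.length * (1111 + 10 * s)) * (V.length + 1) := by
  obtain ⟨V', rfl⟩ := hhead
  -- The case distinction on the sample is settled here once; the empty list gets an arbitrary
  -- state, as nothing is claimed for it.
  have : ∀ first : List ℕ, ∃ σ : GreedyState X, first ≠ [] →
      GreedyInv (a₀ :: V') σ ∧
      (∀ x, x ∈ σ.E ↔ ∃ i ∈ first, (a₀ :: V').getD i a₀ = x) ∧
      σ.E.length ≤ first.length ∧
      ∀ z later, (greedyT (a₀ :: V').length z (a₀ :: V') first later).val =
          (roundsT (a₀ :: V').length z a₀ later σ).val ∧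
        ∀ s, 0 < z → (∀ is ∈ later, is.length = s) →
          (greedyT (a₀ :: V').length z (a₀ :: V') first later).time ≤
            (10 * first.length + 10 + later.length * (1111 + 10 * s)) *
              ((a₀ :: V').length + 1) := by
    intro first
    cases first with
    | nil => exact ⟨⟨[], []⟩, fun h => (h rfl).elim⟩
    | cons i is =>
      refine ⟨_, fun _ => ⟨greedyInv_sampleState _ _ _, fun x => ?_, ?_,
        fun z later => ⟨greedyT_val _ z a₀ V' i is later,
          fun s hz hL => greedyT_time_le hz a₀ V' hV i is hL⟩⟩⟩
      · rw [mem_sampleState, ← List.map_cons (f := fun i => (a₀ :: V').getD i a₀), List.mem_map]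
      · refine (length_sampleState_le _ _ _).trans ?_
        simp
  choose init hinit using this
  exact ⟨init, hinit⟩

theorem coresetT_val (n z : ℕ) (l η : ℝ) (V : List X) (ω : Draws n z l η)
    (h : n = (greedyT n z V (List.ofFn fun i => (ω.1 i : ℕ))
      (List.ofFn fun j => List.ofFn fun i => (ω.2 j i : ℕ))).val.table.length) :
    (coresetT n z l η V ω).val = coresetOutput (2 * z)
      (greedyT n z V (List.ofFn fun i => (ω.1 i : ℕ))
        (List.ofFn fun j => List.ofFn fun i => (ω.2 j i : ℕ))).val := by
  simp only [coresetT, coresetOutput, Timed.tick_val, Timed.bind_val, appendT_val, mapT_val,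
    filterT_val, weightsT_val, ← h]

theorem coresetT_time_le (n z : ℕ) (l η : ℝ) (V : List X) (ω : Draws n z l η)
    (h : n = (greedyT n z V (List.ofFn fun i => (ω.1 i : ℕ))
      (List.ofFn fun j => List.ofFn fun i => (ω.2 j i : ℕ))).val.table.length) :
    (coresetT n z l η V ω).time ≤
      (greedyT n z V (List.ofFn fun i => (ω.1 i : ℕ))
        (List.ofFn fun j => List.ofFn fun i => (ω.2 j i : ℕ))).time +
      (1110 + 5 * (greedyT n z V (List.ofFn fun i => (ω.1 i : ℕ))
        (List.ofFn fun j => List.ofFn fun i => (ω.2 j i : ℕ))).val.E.length) * (n + 1) := by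
  simp only [coresetT, Timed.tick_time, Timed.bind_time, filterT_time, filterT_val, weightsT_time,
    weightsT_val, mapT_time, mapT_val, appendT_time, List.length_map]
  generalize greedyT n z V _ _ = g at *
  have h1 := radiusT_time_le (2 * z) g.val.table
  rw [← h] at h1 ⊢
  have h2 := List.length_filter_le (fun e => decide (e.distE ≤
    (radiusT n (2 * z) g.val.table).val)) g.val.table
  have h3 := List.length_filter_le (fun e => decide (
    (radiusT n (2 * z) g.val.table).val < e.distE)) g.val.table
  rw [← h] at h2 h3
  -- Counting the weights takes one pass over the near rows for each vertex of `E`; this is the term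
  -- `|E| n`.
  have h4 := Nat.mul_le_mul_left g.val.E.length
    (show 2 * (List.filter (fun e => decide (e.distE ≤
    (radiusT n (2 * z) g.val.table).val)) g.val.table).length + 3 ≤ 2 * n + 3 by omega)
  nlinarith

end Output

/-! ## Progress of the greedy algorithm -/

section Progress

variable {X : Type u} [MetricSpace X]

/-- The vertex `p` is farther than `R` from `E`. -/
def FarFrom (R : ℝ) (E : List X) (p : X) : Prop := ∀ s ∈ E, R < dist p s

noncomputable instance (R : ℝ) (E : List X) : DecidablePred (FarFrom R E) := Classical.decPred _

variable [Fintype X]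

/-- The vertices farther than `R` from `E`. -/
noncomputable def farSet (R : ℝ) (E : List X) : Finset X := Finset.univ.filter (FarFrom R E)

/-- The number of balls of radius `r` around `B` that `E` misses, or `0` if at most `m` vertices
are farther than `2 * r` from `E`. -/
noncomputable def missRank (m : ℕ) (r : ℝ) (B : Finset X) (E : List X) : ℕ :=
  if (farSet (2 * r) E).card ≤ m then 0 else (B.filter (FarFrom r E)).card

theorem mem_farSet {R : ℝ} {E : List X} {p : X} : p ∈ farSet R E ↔ ∀ s ∈ E, R < dist p s := by
  simp [farSet, FarFrom]

theorem farSet_anti {R : ℝ} {E E' : List X} (h : ∀ x ∈ E, x ∈ E') :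
    farSet R E' ⊆ farSet R E := fun _ hp =>
  mem_farSet.2 fun s hs => mem_farSet.1 hp s (h s hs)

theorem missRank_le_card (m : ℕ) (r : ℝ) (B : Finset X) (E : List X) :
    missRank m r B E ≤ B.card := by
  rw [missRank]
  split_ifs
  · exact Nat.zero_le _
  · exact Finset.card_filter_le _ _

theorem missRank_anti (m : ℕ) (r : ℝ) (B : Finset X) {E E' : List X} (h : ∀ x ∈ E, x ∈ E') :
    missRank m r B E' ≤ missRank m r B E := by
  have h1 := Finset.card_le_card (farSet_anti (R := 2 * r) h)
  rw [missRank, missRank]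
  split_ifs with h2 h3
  · exact le_rfl
  · exact Nat.zero_le _
  · omega
  · exact Finset.card_le_card (Finset.monotone_filter_right _ fun b _ hb s hs => hb s (h s hs))

theorem lt_card_of_missRank_ne_zero {m : ℕ} {r : ℝ} {B : Finset X} {E : List X}
    (h : missRank m r B E ≠ 0) : m < (farSet (2 * r) E).card := by
  by_contra hc
  exact h (by rw [missRank, if_pos (not_lt.1 hc)])

/-- The ball containing `x` was missed: a point of `E` within `r` of `b` would be within `2r` of
`x`. The point `x` itself hits it. -/
theorem missRank_lt {m : ℕ} {r : ℝ} {B : Finset X} {E E' : List X} (h : ∀ x ∈ E, x ∈ E')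
    (h0 : missRank m r B E ≠ 0) {x : X} (hx : x ∈ farSet (2 * r) E) (hxE : x ∈ E')
    (hB : ∃ b ∈ B, dist x b ≤ r) : missRank m r B E' < missRank m r B E := by
  obtain ⟨b, hb, hxb⟩ := hB
  have h1 := lt_card_of_missRank_ne_zero h0
  have h2 : missRank m r B E' ≤ (B.filter (FarFrom r E')).card := by
    rw [missRank]
    split_ifs
    · exact Nat.zero_le _
    · exact le_rfl
  refine h2.trans_lt ?_
  rw [missRank, if_neg (not_le.2 h1)]
  refine Finset.card_lt_card ?_
  rw [Finset.ssubset_iff_of_subset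
    (Finset.monotone_filter_right _ fun b _ hb s hs => hb s (h s hs))]
  refine ⟨b, Finset.mem_filter.2 ⟨hb, fun s hs => ?_⟩, fun hb' => ?_⟩
  · have h3 := mem_farSet.1 hx s hs
    have h4 := dist_triangle x b s
    linarith
  · have := (Finset.mem_filter.1 hb').2 x hxE
    rw [dist_comm] at this
    exact absurd hxb (not_le.2 this)

variable [DecidableEq X]

/-- If the rank vanishes because every ball is hit, each point of `P` is within `r` of some `b`,
which is within `r` of `E`. Then only the `z ≤ m` points outside `P` can be far. -/
theorem card_farSet_le_of_missRank_eq_zero {m z : ℕ} (hz : z ≤ m) {r : ℝ} {B : Finset X}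
    {E : List X} {P : Finset X} (hP : P.card + z = Fintype.card X)
    (hB : ∀ q ∈ P, ∃ b ∈ B, dist q b ≤ r) (h : missRank m r B E = 0) :
    (farSet (2 * r) E).card ≤ m := by
  by_contra hc
  rw [missRank, if_neg hc, Finset.card_eq_zero, Finset.filter_eq_empty_iff] at h
  have : farSet (2 * r) E ⊆ Pᶜ := by
    intro p hp
    rw [Finset.mem_compl]
    intro hpP
    obtain ⟨b, hb, hpb⟩ := hB p hpP
    have := h hb
    simp only [FarFrom, not_forall, not_lt] at this
    obtain ⟨s, hs, hsb⟩ := this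
    have h1 := mem_farSet.1 hp s hs
    have h2 := dist_triangle p b s
    linarith
  have := Finset.card_le_card this
  rw [Finset.card_compl] at this
  omega

theorem GreedyInv.countP_eq_card_farSet {V : List X} {σ : GreedyState X} (hσ : GreedyInv V σ)
    (hn : V.Nodup) (hV : ∀ x, x ∈ V) (R : ℝ) :
    σ.table.countP (fun e => decide (R < e.distE)) = (farSet R σ.E).card := by
  classical
  have h1 : farSet R σ.E = (V.filter fun p => decide (p ∈ farSet R σ.E)).toFinset := by
    ext p; simp [hV]
  rw [h1, List.toFinset_card_of_nodup (hn.filter _), ← List.countP_eq_length_filter]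
  conv_rhs => rw [← hσ.vertices]
  rw [List.countP_map]
  refine List.countP_congr fun e he => ?_
  simp only [Function.comp, decide_eq_true_eq, mem_farSet]
  constructor
  · exact fun h s hs => h.trans_le (hσ.distE_le e he s hs)
  · intro h
    rw [hσ.distE_eq e he]
    exact h _ (hσ.nearest_mem e he)

omit [MetricSpace X] in
/-- At most `z` positions of a list without repetitions hold one of the `z` outliers. -/
theorem card_getD_notMem_le {P : Finset X} {z N : ℕ} (hP : P.card + z = Fintype.card X)
    {Q : List X} (hQ : Q.Nodup) (hN : N ≤ Q.length) (a₀ : X) :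
    (Finset.univ.filter fun i : Fin N => ¬ Q.getD i a₀ ∈ P).card ≤ z := by
  have h1 : (Finset.univ.filter fun i : Fin N => ¬ Q.getD i a₀ ∈ P).card ≤ Pᶜ.card := by
    refine Finset.card_le_card_of_injOn (fun i => Q.getD i a₀) ?_ ?_
    · intro i hi
      simpa using hi
    · intro i _ j _ hij
      have hi : (i : ℕ) < Q.length := i.2.trans_le hN
      have hj : (j : ℕ) < Q.length := j.2.trans_le hN
      simp only [List.getD_eq_getElem _ _ hi, List.getD_eq_getElem _ _ hj] at hij
      exact Fin.ext ((hQ.getElem_inj_iff).1 hij)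
  rw [Finset.card_compl] at h1
  omega

/-- Each later round lowers the rank with probability at least `1 - η`. -/
theorem GreedyInv.card_roundT_le {V : List X} {σ : GreedyState X} (hσ : GreedyInv V σ)
    (hn : V.Nodup) (hV : ∀ x, x ∈ V) {η : ℝ} (h0 : 0 < η) {z : ℕ} (hz : 0 < z) (a₀ : X)
    {P B : Finset X} {r : ℝ} (hP : P.card + z = Fintype.card X)
    (hB : ∀ q ∈ P, ∃ b ∈ B, dist q b ≤ r) (hrank : missRank (2 * z) r B σ.E ≠ 0) :
    ((Finset.univ.filter fun d : Fin (roundSize η) → Fin (min (2 * z) V.length) =>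
      missRank (2 * z) r B σ.E ≤ missRank (2 * z) r B
        (_root_.roundT V.length z a₀ σ (List.ofFn fun i => (d i : ℕ))).val.E).card : ℝ) ≤
      η * Fintype.card (Fin (roundSize η) → Fin (min (2 * z) V.length)) := by
  have h1 := lt_card_of_missRank_ne_zero hrank
  rw [← hσ.countP_eq_card_farSet hn hV] at h1
  -- Positive rank forces `n > 2z`, so the draws range over exactly `2z` vertices and an outlier has
  -- probability at most `z/(2z)`.
  have hlt : 2 * z < V.length := by
    rw [← hσ.table_length]; exact h1.trans_le List.countP_le_length
  have hfar := farthestT_far (by omega) h1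
  have hnd := farthestT_nodup (2 * z) (tab := σ.table) (hσ.vertices ▸ hn)
  have hlen := farthestT_length (m := 2 * z) (by omega) σ.table
  rw [hσ.table_length] at hfar hnd hlen
  have hcount := card_getD_notMem_le hP hnd hlen.ge a₀
  have hD : ((Finset.univ.filter fun i : Fin (min (2 * z) V.length) =>
      ¬ (farthestT V.length (2 * z) σ.table).val.getD i a₀ ∈ P).card : ℝ) ≤
      1 / 2 * Fintype.card (Fin (min (2 * z) V.length)) := by
    have h2 : (1 / 2 : ℝ) * Fintype.card (Fin (min (2 * z) V.length)) = z := by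
      rw [Fintype.card_fin, min_eq_left hlt.le]
      push_cast
      ring
    rw [h2]
    exact_mod_cast hcount
  have hmiss := card_forall_not_le (fun i : Fin (min (2 * z) V.length) =>
    (farthestT V.length (2 * z) σ.table).val.getD i a₀ ∈ P) hD (roundSize η)
  refine le_trans ?_ (hmiss.trans (mul_le_mul_of_nonneg_right (half_pow_roundSize_le h0)
    (Nat.cast_nonneg _)))
  -- A round that does not lower the rank drew outliers only, since every vertex on offer is farther
  -- than `2r` from `E`.
  exact_mod_cast Finset.card_le_card fun d hd => by
    simp only [Finset.mem_filter, Finset.mem_univ, true_and] at hd ⊢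
    intro i hi
    have hi' : ((d i : Fin _) : ℕ) < (farthestT V.length (2 * z) σ.table).val.length :=
      (d i).2.trans_eq hlen.symm
    refine absurd hd (not_le.2 (missRank_lt (fun x hx => mem_roundT.2 (Or.inr hx)) hrank
      (x := (farthestT V.length (2 * z) σ.table).val.getD (d i) a₀) ?_ ?_ (hB _ hi)))
    · obtain ⟨e, he, hev, heR⟩ := hfar _ (List.getElem_mem hi')
      rw [List.getD_eq_getElem _ _ hi']
      rw [← hev]
      exact mem_farSet.2 fun s hs => heR.trans_le (hσ.distE_le e he s hs)
    · exact mem_roundT.2 (Or.inl ⟨_, List.mem_ofFn.2 ⟨i, rfl⟩, rfl⟩)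

open Classical in
/-- The probability that the greedy algorithm leaves more than `2 * z` vertices uncovered. -/
theorem card_greedy_fail_le {V : List X} (hn : V.Nodup) (hV : ∀ x, x ∈ V) {η : ℝ} (h0 : 0 < η)
    (h1 : η < 1) {z : ℕ} (hz : 0 < z) (hzn : z < V.length) (a₀ : X) {P B : Finset X} {r : ℝ}
    (hP : P.card + z = Fintype.card X) (hB : ∀ q ∈ P, ∃ b ∈ B, dist q b ≤ r)
    (init : List ℕ → GreedyState X)
    (hinv : ∀ first, first ≠ [] → GreedyInv V (init first))
    (hinit : ∀ first, first ≠ [] → ∀ x, x ∈ (init first).E ↔ ∃ i ∈ first, V.getD i a₀ = x)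
    (T : ℕ) :
    ((Finset.univ.filter fun ω : (Fin (initialSize V.length z η) → Fin V.length) ×
        (Fin T → Fin (roundSize η) → Fin (min (2 * z) V.length)) =>
      missRank (2 * z) r B (roundsT V.length z a₀
        (List.ofFn fun j => List.ofFn fun i => (ω.2 j i : ℕ))
        (init (List.ofFn fun i => (ω.1 i : ℕ)))).val.E ≠ 0).card : ℝ) ≤
      failBound η (T + 1) B.card *
        Fintype.card ((Fin (initialSize V.length z η) → Fin V.length) ×
        (Fin T → Fin (roundSize η) → Fin (min (2 * z) V.length))) := by
  have hne : ∀ ω : Fin (initialSize V.length z η) → Fin V.length,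
      (List.ofFn fun i => (ω i : ℕ)) ≠ [] := fun ω h => by
    have := initialSize_pos h0 h1 hzn
    have h2 := congrArg List.length h
    simp at h2
    omega
  have later := fun σ (hσ : GreedyInv V σ) => card_rank_ne_zero_le h0.le h1.le
    (D := Fin (roundSize η) → Fin (min (2 * z) V.length))
    (fun σ d => (roundT V.length z a₀ σ (List.ofFn fun i => (d i : ℕ))).val)
    (GreedyInv V) (fun σ => missRank (2 * z) r B σ.E)
    (fun σ d h => h.roundT _ _ _ _)
    (fun σ d _ => missRank_anti _ _ _ fun x hx => mem_roundT.2 (Or.inr hx))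
    (fun σ h hr => by
      refine le_trans (le_of_eq ?_) (h.card_roundT_le hn hV h0 hz a₀ hP hB hr)
      congr!) T σ hσ
  have hrun : ∀ (ω : Fin T → Fin (roundSize η) → Fin (min (2 * z) V.length)) (σ : GreedyState X),
      (roundsT V.length z a₀ (List.ofFn fun j => List.ofFn fun i => (ω j i : ℕ)) σ).val =
      (List.ofFn ω).foldl
        (fun σ d => (roundT V.length z a₀ σ (List.ofFn fun i => (d i : ℕ))).val) σ := by
    intro ω σ
    rw [roundsT_val, show (List.ofFn fun j => List.ofFn fun i => (ω j i : ℕ)) =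
      (List.ofFn ω).map fun d => List.ofFn fun i => (d i : ℕ) by
        rw [List.map_ofFn]; rfl, List.foldl_map]
  have key : ((Finset.univ.filter fun ω : (Fin (initialSize V.length z η) → Fin V.length) ×
        (Fin T → Fin (roundSize η) → Fin (min (2 * z) V.length)) =>
      missRank (2 * z) r B (roundsT V.length z a₀
        (List.ofFn fun j => List.ofFn fun i => (ω.2 j i : ℕ))
        (init (List.ofFn fun i => (ω.1 i : ℕ)))).val.E ≠ 0).card : ℝ) =
      ∑ ω₁ : Fin (initialSize V.length z η) → Fin V.length,
        ((Finset.univ.filter fun ω₂ : Fin T → Fin (roundSize η) → Fin (min (2 * z) V.length) =>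
          missRank (2 * z) r B ((List.ofFn ω₂).foldl
            (fun σ d => (roundT V.length z a₀ σ (List.ofFn fun i => (d i : ℕ))).val)
            (init (List.ofFn fun i => (ω₁ i : ℕ)))).E ≠ 0).card : ℝ) := by
    simp only [← Finset.sum_boole, Fintype.sum_prod_type, hrun]
  rw [key, Fintype.card_prod, Nat.cast_mul]
  set N := (Fintype.card (Fin (roundSize η) → Fin (min (2 * z) V.length)) : ℝ) with hN
  have hcT : (Fintype.card (Fin T → Fin (roundSize η) → Fin (min (2 * z) V.length)) : ℝ) =
      N ^ T := by
    rw [Fintype.card_fun (α := Fin T), Fintype.card_fin, Nat.cast_pow]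
  rw [hcT]
  have hNT : 0 ≤ N ^ T := by positivity
  have mono := failBound_mono h0.le h1.le T
  have hrank : ∀ ω₁ : Fin (initialSize V.length z η) → Fin V.length,
      missRank (2 * z) r B (init (List.ofFn fun i => (ω₁ i : ℕ))).E ≤
        missRank (2 * z) r B [] := fun ω₁ => missRank_anti _ _ _ (by simp)
  -- Starting from the rank of the empty set makes the initial sample the first of `T + 1` trials.
  refine le_trans (b := failBound η (T + 1) (missRank (2 * z) r B []) *
    (Fintype.card (Fin (initialSize V.length z η) → Fin V.length) * N ^ T)) ?_
    (mul_le_mul_of_nonneg_right (failBound_mono h0.le h1.le (T + 1) (missRank_le_card _ _ _ _))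
      (by positivity))
  rcases Nat.eq_zero_or_pos (missRank (2 * z) r B []) with h | h
  · rw [h, failBound_zero, zero_mul]
    refine Finset.sum_nonpos fun ω₁ _ => ?_
    have h2 := later _ (hinv _ (hne ω₁))
    rwa [Nat.le_zero.1 ((hrank ω₁).trans h.le), failBound_zero, zero_mul] at h2
  · obtain ⟨m, hm⟩ := Nat.exists_eq_succ_of_ne_zero h.ne'
    have hcard : V.length = Fintype.card X := by
      rw [← List.toFinset_card_of_nodup hn, ← Finset.card_univ]
      congr 1
      ext x; simp [hV]
    have hD : ((Finset.univ.filter fun i : Fin V.length => ¬ V.getD i a₀ ∈ P).card : ℝ) ≤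
        (z : ℝ) / V.length * Fintype.card (Fin V.length) := by
      have hV0 : (V.length : ℝ) ≠ 0 := by
        have : 0 < V.length := by omega
        positivity
      rw [Fintype.card_fin, div_mul_cancel₀ _ hV0]
      exact_mod_cast card_getD_notMem_le hP hn le_rfl a₀
    have hmiss := (card_forall_not_le (fun i : Fin V.length => V.getD i a₀ ∈ P) hD
      (initialSize V.length z η)).trans
      (mul_le_mul_of_nonneg_right (pow_initialSize_le h0 hzn) (Nat.cast_nonneg _))
    have := sum_le_of_card_bad_le
      (f := fun ω₁ : Fin (initialSize V.length z η) → Fin V.length =>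
        ((Finset.univ.filter fun ω₂ : Fin T → Fin (roundSize η) → Fin (min (2 * z) V.length) =>
          missRank (2 * z) r B ((List.ofFn ω₂).foldl
            (fun σ d => (roundT V.length z a₀ σ (List.ofFn fun i => (d i : ℕ))).val)
            (init (List.ofFn fun i => (ω₁ i : ℕ)))).E ≠ 0).card : ℝ))
      (bad := fun ω₁ => ∀ i, ¬ V.getD (ω₁ i) a₀ ∈ P)
      (a := failBound η T m * N ^ T) (b := failBound η T (m + 1) * N ^ T) (η := η)
      (mul_le_mul_of_nonneg_right (mono m.le_succ) hNT)
      (fun ω₁ => (later _ (hinv _ (hne ω₁))).trans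
        (mul_le_mul_of_nonneg_right (mono ((hrank ω₁).trans hm.le)) hNT))
      (fun ω₁ hω => by
        refine (later _ (hinv _ (hne ω₁))).trans
          (mul_le_mul_of_nonneg_right (mono ?_) hNT)
        push Not at hω
        obtain ⟨i, hi⟩ := hω
        -- Every vertex is vacuously far from the empty list, so any sampled inlier hits a missed
        -- ball.
        have := missRank_lt (E' := (init (List.ofFn fun i => (ω₁ i : ℕ))).E) (by simp) h.ne'
          (x := V.getD (ω₁ i) a₀) (by simp [mem_farSet])
          ((hinit _ (hne ω₁) _).2 ⟨_, List.mem_ofFn.2 ⟨i, rfl⟩, rfl⟩) (hB _ hi)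
        omega)
      (by refine le_trans (le_of_eq ?_) hmiss; congr!)
    refine this.trans (le_of_eq ?_)
    rw [hm]
    simp only [failBound]
    ring

end Progress

/-! ### Explicit constants and the final bounds -/

section Main

theorem numRounds_le {l η : ℝ} (h1 : η < 1) (hl : 1 ≤ l) :
    (numRounds l η : ℝ) ≤ (2 / (1 - η) + 1) * l := by
  have h2 : 0 < 1 - η := by linarith
  have hs : Real.sqrt l ≤ l := Real.sqrt_le_iff.2 ⟨by linarith, by nlinarith⟩
  have h3 : (numRounds l η : ℝ) < (l + Real.sqrt l) / (1 - η) + 1 :=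
    Nat.ceil_lt_add_one (by positivity)
  have h4 : (l + Real.sqrt l) / (1 - η) ≤ 2 / (1 - η) * l := by
    rw [div_mul_eq_mul_div]
    exact div_le_div_of_nonneg_right (by linarith) h2.le
  linarith

/-- Here `z ≤ γ₀ n` enters: it keeps `1 - z/n` away from `0`. -/
theorem initialSize_le {η γ₀ : ℝ} (h0 : 0 < η) (h1 : η < 1) (hγ : γ₀ < 1) {n z : ℕ}
    (hn : 0 < n) (hz : (z : ℝ) ≤ γ₀ * n) :
    (initialSize n z η : ℝ) ≤ Real.log (1 / η) / (1 - γ₀) + 1 := by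
  have hn' : (0 : ℝ) < n := by exact_mod_cast hn
  have h2 : 0 < 1 - γ₀ := by linarith
  have h3 : (z : ℝ) / n ≤ γ₀ := by rwa [div_le_iff₀ hn']
  have hlog : 0 ≤ Real.log (1 / η) := Real.log_nonneg (by rw [le_div_iff₀ h0]; linarith)
  have h4 : 0 < 1 - (z : ℝ) / n := by linarith
  have h5 : (initialSize n z η : ℝ) < 1 / (1 - (z : ℝ) / n) * Real.log (1 / η) + 1 :=
    Nat.ceil_lt_add_one (by positivity)
  have h6 : 1 / (1 - (z : ℝ) / n) * Real.log (1 / η) ≤ Real.log (1 / η) / (1 - γ₀) := by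
    rw [one_div_mul_eq_div]
    exact div_le_div_of_nonneg_left hlog h2 (by linarith)
  linarith

variable {X : Type u} [MetricSpace X] [Fintype X] [DecidableEq X]

/-- With balls of radius `μ/2` times the optimal cost, final rank `0` leaves at most `2z` vertices
beyond `μ` times that cost. The radius is then small enough for `GreedyInv.isCoreset`, so failure is
contained in the event of positive rank. -/
theorem le_coresetProb {V : List X} (hn : V.Nodup) (hV : ∀ x, x ∈ V) {η : ℝ} (h0 : 0 < η)
    (h1 : η < 1) {k z : ℕ} {l μ : ℝ} (hl : 1 ≤ l) (hμ : 0 ≤ μ) {Xopt A B : Finset X}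
    (hz : 0 < z) (hzn : z < Fintype.card X) (hopt : IsOptimalSolution k z Xopt A)
    (hBc : (B.card : ℝ) ≤ l)
    (hB : ∀ q ∈ Xopt, ∃ b ∈ B, dist q b ≤ μ * clusterCost Xopt A / 2) :
    1 / (1 + 2 * η) ≤ coresetProb μ k z l η V := by
  classical
  have hcard : V.length = Fintype.card X := by
    rw [← List.toFinset_card_of_nodup hn, ← Finset.card_univ]
    congr 1
    ext x; simp [hV]
  rw [coresetProb, ← hcard]
  rw [← hcard] at hzn
  obtain ⟨a₀, hhead⟩ : ∃ a₀ V', V = a₀ :: V' := List.exists_cons_of_length_pos (by omega)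
  obtain ⟨init, hinit⟩ := exists_greedyT_eq hhead hV
  have hfail := card_greedy_fail_le hn hV h0 h1 hz hzn a₀ hopt.1 hB init
    (fun f hf => (hinit f hf).1) (fun f hf => (hinit f hf).2.1) (numRounds l η - 1)
  have hrounds : 0 < numRounds l η :=
    Nat.ceil_pos.2 (div_pos (by positivity) (by linarith))
  -- The `t - 1` later rounds and the initial sample make `t` trials.
  rw [Nat.sub_add_cancel hrounds] at hfail
  have hbound := failBound_le_of_rounds (T := numRounds l η) h0 h1 hl hBc (Nat.le_ceil _)
  have hpos : (0 : ℝ) < Fintype.card (Draws V.length z l η) := by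
    have : NeZero V.length := ⟨by omega⟩
    have : NeZero (min (2 * z) V.length) := ⟨by omega⟩
    exact_mod_cast Fintype.card_pos
  have hsub : (Finset.univ.filter fun ω : Draws V.length z l η =>
      ¬ IsCoreset μ k z (outSet (coresetT V.length z l η V ω).val)
        (outWeight (coresetT V.length z l η V ω).val)).card ≤ (Finset.univ.filter
      fun ω : Draws V.length z l η =>
      missRank (2 * z) (μ * clusterCost Xopt A / 2) B (roundsT V.length z a₀
        (List.ofFn fun j => List.ofFn fun i => (ω.2 j i : ℕ))
        (init (List.ofFn fun i => (ω.1 i : ℕ)))).val.E ≠ 0).card := by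
    refine Finset.card_le_card fun ω hω => ?_
    simp only [Finset.mem_filter, Finset.mem_univ, true_and] at hω ⊢
    intro hr
    refine hω ?_
    have hne : (List.ofFn fun i => (ω.1 i : ℕ)) ≠ [] := fun h => by
      have := initialSize_pos h0 h1 hzn
      have h2 := congrArg List.length h
      simp at h2
      omega
    obtain ⟨hinv, -, -, hgreedy⟩ := hinit _ hne
    obtain ⟨hval, -⟩ := hgreedy z (List.ofFn fun j => List.ofFn fun i => (ω.2 j i : ℕ))
    have hσ := hinv.roundsT V.length z a₀ (List.ofFn fun j => List.ofFn fun i => (ω.2 j i : ℕ))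
    rw [coresetT_val _ _ _ _ _ _ (by rw [hval, hσ.table_length]), hval]
    refine hσ.isCoreset hn hV hμ hopt (radiusT_le (mul_nonneg hμ (clusterCost_nonneg _ _)) ?_)
    rw [hσ.countP_eq_card_farSet hn hV]
    have := card_farSet_le_of_missRank_eq_zero (by omega) hopt.1 hB hr
    rwa [mul_div_cancel₀ _ (two_ne_zero)] at this
  have hsum := Finset.card_filter_add_card_filter_not (s := Finset.univ)
    (fun ω : Draws V.length z l η => IsCoreset μ k z
      (outSet (coresetT V.length z l η V ω).val) (outWeight (coresetT V.length z l η V ω).val))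
  rw [Finset.card_univ] at hsum
  rw [le_div_iff₀ hpos]
  have h2 := mul_le_mul_of_nonneg_right hbound hpos.le
  have h3 : ((Finset.univ.filter fun ω : Draws V.length z l η =>
      ¬ IsCoreset μ k z (outSet (coresetT V.length z l η V ω).val)
        (outWeight (coresetT V.length z l η V ω).val)).card : ℝ) ≤
      failBound η (numRounds l η) B.card * Fintype.card (Draws V.length z l η) :=
    le_trans (by exact_mod_cast hsub) hfail
  have h4 := congrArg (Nat.cast (R := ℝ)) hsum
  push_cast at h4
  linarith

omit [Fintype X] in
-- No probability is involved: `E` has at most one vertex per draw, and at most `2z` vertices lie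
-- beyond the radius.
theorem coresetT_size_time_le {V : List X} (hV : ∀ x, x ∈ V) {η : ℝ} (h0 : 0 < η)
    (h1 : η < 1) {z : ℕ} {l : ℝ} (hz : 0 < z) (hzn : z < V.length) (ω : Draws V.length z l η) :
    (outSet (coresetT V.length z l η V ω).val).card ≤
      initialSize V.length z η + numRounds l η * roundSize η + 2 * z ∧
    (coresetT V.length z l η V ω).time ≤
      (15 * initialSize V.length z η + 1120 + numRounds l η * (1111 + 15 * roundSize η)) *
        (V.length + 1) := by
  obtain ⟨a₀, hhead⟩ : ∃ a₀ V', V = a₀ :: V' := List.exists_cons_of_length_pos (by omega)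
  obtain ⟨init, hinit⟩ := exists_greedyT_eq hhead hV
  have hne : (List.ofFn fun i => (ω.1 i : ℕ)) ≠ [] := fun h => by
    have := initialSize_pos h0 h1 hzn
    have h2 := congrArg List.length h
    simp at h2
    omega
  have hL : ∀ is ∈ (List.ofFn fun j => List.ofFn fun i => (ω.2 j i : ℕ)),
      is.length = roundSize η := by
    intro is his
    obtain ⟨j, rfl⟩ := List.mem_ofFn.1 his
    simp
  obtain ⟨hinv, -, hlen, hgreedy⟩ := hinit _ hne
  obtain ⟨hval, htime⟩ := hgreedy z (List.ofFn fun j => List.ofFn fun i => (ω.2 j i : ℕ))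
  have hσ := hinv.roundsT V.length z a₀ (List.ofFn fun j => List.ofFn fun i => (ω.2 j i : ℕ))
  have htab : V.length = (greedyT V.length z V (List.ofFn fun i => (ω.1 i : ℕ))
      (List.ofFn fun j => List.ofFn fun i => (ω.2 j i : ℕ))).val.table.length := by
    rw [hval, hσ.table_length]
  have hE := length_roundsT_le V.length z a₀ hL (init (List.ofFn fun i => (ω.1 i : ℕ)))
  rw [← hval] at hE
  replace htime := htime (roundSize η) hz hL
  have ht := coresetT_time_le V.length z l η V ω htab
  have hs := card_outSet_coresetOutput_le (2 * z) (greedyT V.length z V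
    (List.ofFn fun i => (ω.1 i : ℕ)) (List.ofFn fun j => List.ofFn fun i => (ω.2 j i : ℕ))).val
  rw [← coresetT_val V.length z l η V ω htab] at hs
  rw [List.length_ofFn] at hlen htime hE
  rw [List.length_ofFn] at htime
  have hT : numRounds l η - 1 ≤ numRounds l η := Nat.sub_le _ _
  have hTs := Nat.mul_le_mul_right (roundSize η) hT
  have hTs' := Nat.mul_le_mul_right (1111 + 10 * roundSize η) hT
  refine ⟨by omega, ?_⟩
  refine ht.trans ((Nat.add_le_add_right htime _).trans ?_)
  rw [← add_mul]
  refine Nat.mul_le_mul_right _ ?_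
  nlinarith

end Main

theorem theorem7 (η : ℝ) (hη0 : 0 < η) (hη1 : η < 1) :
    ∃ p : ℝ, 0 < p ∧ ∀ γ₀ : ℝ, γ₀ < 1 → ∃ C : ℝ, 0 < C ∧
      ∀ (X : Type u) [MetricSpace X] [Fintype X] [DecidableEq X]
        (V : List X) (k z : ℕ) (ρ μ κ : ℝ) (Xopt A : Finset X),
        V.Nodup → (∀ x : X, x ∈ V) →
        0 < k → 0 < z → z < Fintype.card X → (z : ℝ) ≤ γ₀ * Fintype.card X →
        0 < μ → μ < 1 → 0 < ρ →
        IsOptimalSolution k z Xopt A → DoublingDimLE Xopt ρ →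
        (κ = 4 ^ ρ ∨ (κ = 1 ∧ A ⊆ Xopt ∧ ∃ i : ℕ, μ = 1 / 2 ^ i)) →
        p ≤ coresetProb μ k z (κ * (2 / μ) ^ ρ * k) η V ∧
        ∀ ω : Draws (Fintype.card X) z (κ * (2 / μ) ^ ρ * k) η,
          ((outSet (coresetT (Fintype.card X) z (κ * (2 / μ) ^ ρ * k) η V ω).val).card : ℝ) ≤
              2 * z + C * (κ * (2 / μ) ^ ρ * k) ∧
          ((coresetT (Fintype.card X) z (κ * (2 / μ) ^ ρ * k) η V ω).time : ℝ) ≤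
              C * (κ * (2 / μ) ^ ρ * k) * Fintype.card X := by
  refine ⟨1 / (1 + 2 * η), by positivity, fun γ₀ hγ => ?_⟩
  have h2 : 0 < 1 - η := by linarith
  have h3 : 0 < 1 - γ₀ := by linarith
  have hlog : 0 ≤ Real.log (1 / η) := Real.log_nonneg (by rw [le_div_iff₀ hη0]; linarith)
  obtain ⟨c, hc⟩ : ∃ c, c = Real.log (1 / η) / (1 - γ₀) + 1 := ⟨_, rfl⟩
  obtain ⟨a, ha⟩ : ∃ a, a = 2 / (1 - η) + 1 := ⟨_, rfl⟩
  have hc0 : 0 ≤ c := by rw [hc]; positivity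
  have ha0 : 0 ≤ a := by rw [ha]; positivity
  -- The time bound of `coresetT_size_time_le` with `c` for the initial sample and `a l` for the
  -- rounds; `l ≥ 1` absorbs the constant terms, and the factor `2` comes from `n + 1 ≤ 2n`.
  refine ⟨2 * (15 * c + 1120 + a * (1111 + 15 * roundSize η)), by positivity, ?_⟩
  intro X _ _ _ V k z ρ μ κ Xopt A hn hV hk hz hzn hzγ hμ0 hμ1 hρ hopt hdim hκ
  have hA : A.Nonempty := Finset.card_pos.1 (hopt.2.1 ▸ hk)
  obtain ⟨B, hBc, hB⟩ := exists_inlier_cover hA hμ0 hμ1 hρ hdim hκ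
  rw [hopt.2.1] at hBc
  have hl : 1 ≤ κ * (2 / μ) ^ ρ * k := by
    have e1 : 1 ≤ κ := by
      rcases hκ with rfl | ⟨rfl, -⟩
      · exact Real.one_le_rpow (by norm_num) hρ.le
      · exact le_rfl
    have e2 : 1 ≤ (2 / μ) ^ ρ :=
      Real.one_le_rpow (by rw [le_div_iff₀ hμ0]; linarith) hρ.le
    have e3 : (1 : ℝ) ≤ k := by exact_mod_cast hk
    exact one_le_mul_of_one_le_of_one_le (one_le_mul_of_one_le_of_one_le e1 e2) e3
  -- From here on only `1 ≤ l` and `|B| ≤ l` matter.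
  generalize κ * (2 / μ) ^ ρ * k = l at *
  refine ⟨le_coresetProb hn hV hη0 hη1 hl hμ0.le hz hzn hopt hBc hB, ?_⟩
  have hcard : Fintype.card X = V.length := by
    rw [← List.toFinset_card_of_nodup hn, ← Finset.card_univ]
    congr 1
    ext x; simp [hV]
  rw [hcard] at hzn hzγ ⊢
  intro ω
  obtain ⟨hsize, htime⟩ := coresetT_size_time_le hV hη0 hη1 hz hzn ω
  have hinit := initialSize_le hη0 hη1 hγ (by omega) hzγ
  have hround := numRounds_le hη1 hl
  rw [← hc] at hinit
  rw [← ha] at hround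
  have hsize' := Nat.cast_le (α := ℝ) |>.2 hsize
  have htime' := Nat.cast_le (α := ℝ) |>.2 htime
  push_cast at hsize' htime'
  have hs0 : (0 : ℝ) ≤ roundSize η := Nat.cast_nonneg _
  have hn1 : (1 : ℝ) ≤ V.length := by exact_mod_cast (by omega : 1 ≤ V.length)
  have hcl : c ≤ c * l := le_mul_of_one_le_right hc0 hl
  constructor
  · have e1 := mul_le_mul_of_nonneg_right hround hs0
    have e2 : 0 ≤ a * l := by positivity
    have e3 : 0 ≤ a * l * roundSize η := by positivity
    nlinarith
  · have e1 := mul_le_mul_of_nonneg_right hround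
      (by positivity : (0 : ℝ) ≤ 1111 + 15 * roundSize η)
    calc ((coresetT V.length z l η V ω).time : ℝ)
        ≤ (15 * initialSize V.length z η + 1120 +
          numRounds l η * (1111 + 15 * roundSize η)) * (V.length + 1) := htime'
      _ ≤ (15 * c + 1120 + a * (1111 + 15 * roundSize η)) * l * (2 * V.length) := by
        refine mul_le_mul (by nlinarith) (by linarith) (by positivity) (by positivity)
      _ = _ := by ring
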